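/- Let $k$ be a local field of characteristic zero, i.e. $k=\mathbb R$ or $\mathbb C$ with the usual absolute value, or a locally compact, non-trivially and non-archimedeanly valued field of characteristic zero. If $k$ is non-archimedean, all seminorms and norms below are understood to satisfy the strong triangle inequality. A locally convex $k$-vector space is a topological $k$-vector space whose topology is defined by a family of seminorms; a Fréchet space is a Hausdorff, metrizable, complete locally convex space. A continuous linear map $T:E\to F$ of Banach spaces is nuclear if there are $\varphi_n\in E^{*}$ and $y_n\in F$ with $T(x)=\sum_{n}\varphi_n(x)\,y_n$ for all $x\in E$, where $\sum_n\|\varphi_n\|\,\|y_n\|<\infty$ if $k$ is archimedean, and $\|\varphi_n\|\,\|y_n\|\to 0$ if $k$ is non-archimedean. A continuous linear map $V\to W$ of locally convex spaces is nuclear if it factors through continuous linear maps $V\to E\to F\to W$ with $E,F$ Banach spaces and $E\to F$ nuclear. For a continuous seminorm $p$ on $V$ let $\widehat V_p$ be the Hausdorff completion of $V$ with respect to $p$. The space $V$ is nuclear if for every continuous seminorm $p$ there is a continuous seminorm $q\ge p$ such that the canonical map $\widehat V_q\to\widehat V_p$ is nuclear (if $k$ is archimedean), respectively compact (if $k$ is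 non-archimedean). An (FN)-space is a nuclear Fréchet space; a (DFN)-space is a space topologically isomorphic to the strong dual of an (FN)-space. **Proposition.** Let $V$ be an (FN)-space and $W$ a (DFN)-space over $k$. Then: 1. every continuous linear map $f:V\to W$ is nuclear; 2. every continuous linear map $g:W\to V$ is nuclear. -/

import Mathlib

open Filter Topology

universe uk u v w

/-- A local field of characteristic zero together with its absolute value: a locally compact,
nontrivially normed field of characteristic zero which is either non-archimedean, or `ℝ` or `ℂ`
with the usual absolute value. -/
structure IsLocalFieldCharZero (k : Type uk) [NontriviallyNormedField k] : Prop where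
  charZero : CharZero k
  locallyCompact : LocallyCompactSpace k
  archimedean_or_not : IsRCLikeNormedField k ∨ IsUltrametricDist k

section Seminorms

variable {k : Type uk} [NontriviallyNormedField k] {E : Type u} [AddCommGroup E] [Module k E]

/-- The seminorms that define locally convex topologies: all seminorms if `k` is archimedean,
and the seminorms satisfying the strong triangle inequality if `k` is non-archimedean. -/
def Seminorm.IsAdmissible (p : Seminorm k E) : Prop :=
  IsUltrametricDist k → ∀ x y : E, p (x + y) ≤ max (p x) (p y)

/-- The vector space `E` endowed with the seminorm `p` (and with the topology it defines). -/
def SeminormSpace (_p : Seminorm k E) : Type u := E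

noncomputable instance (p : Seminorm k E) : SeminormedAddCommGroup (SeminormSpace p) :=
  p.toAddGroupSeminorm.toSeminormedAddCommGroup

noncomputable instance (p : Seminorm k E) : NormedSpace k (SeminormSpace p) where
  toModule := (inferInstance : Module k E)
  norm_smul_le a x := (map_smul_eq_mul p a (show E from x)).le

/-- The Banach space attached to a seminorm `p` on `E`: the (Hausdorff) completion of `E`
with respect to `p`. -/
abbrev LocalBanach (p : Seminorm k E) : Type u := UniformSpace.Completion (SeminormSpace p)

/-- For `p ≤ q`, the identity of `E` as a continuous map from `(E, q)` to `(E, p)`. -/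
noncomputable def SeminormSpace.incl {p q : Seminorm k E} (h : p ≤ q) :
    SeminormSpace q →L[k] SeminormSpace p :=
  LinearMap.mkContinuous
    ({ toFun := fun x => x
       map_add' := fun _ _ => rfl
       map_smul' := fun _ _ => rfl } : SeminormSpace q →ₗ[k] SeminormSpace p)
    1 (fun x => by rw [one_mul]; exact h (show E from x))

/-- For `p ≤ q`, the canonical map from the completion for `q` to the completion for `p`. -/
noncomputable def LocalBanach.link {p q : Seminorm k E} (h : p ≤ q) :
    LocalBanach q →L[k] LocalBanach p :=
  (SeminormSpace.incl h).completion

end Seminorms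

section NuclearMaps

variable {k : Type uk} [NontriviallyNormedField k]

/-- Nuclear operators between Banach spaces: `T x = ∑ φ n x • y n`, where `∑ ‖φ n‖ * ‖y n‖ < ∞` if
`k` is archimedean, and `‖φ n‖ * ‖y n‖ → 0` if `k` is non-archimedean; that is, `T` is in the
image of the completed projective tensor product of the dual of `E` with `F`. -/
def IsNuclearOperator {E : Type u} {F : Type v} [NormedAddCommGroup E] [NormedSpace k E]
    [NormedAddCommGroup F] [NormedSpace k F] (T : E →L[k] F) : Prop :=
  ∃ (φ : ℕ → StrongDual k E) (y : ℕ → F),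
    (IsUltrametricDist k → Tendsto (fun n => ‖φ n‖ * ‖y n‖) atTop (𝓝 0)) ∧
    (¬ IsUltrametricDist k → Summable fun n => ‖φ n‖ * ‖y n‖) ∧
    ∀ x, HasSum (fun n => φ n x • y n) (T x)

/-- A continuous linear map between locally convex spaces is nuclear if it factors as
`V → E → F → W` with continuous linear maps, where `E`, `F` are Banach spaces
(with ultrametric norms if `k` is non-archimedean) and `E → F` is a nuclear operator. -/
def IsNuclearMap {V : Type u} {W : Type v} [AddCommGroup V] [Module k V] [TopologicalSpace V]
    [AddCommGroup W] [Module k W] [TopologicalSpace W] (f : V →L[k] W) : Prop :=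
  ∃ (E : Type u) (_ : NormedAddCommGroup E) (_ : NormedSpace k E)
    (F : Type v) (_ : NormedAddCommGroup F) (_ : NormedSpace k F)
    (a : V →L[k] E) (T : E →L[k] F) (b : F →L[k] W),
    CompleteSpace E ∧ CompleteSpace F ∧
    (IsUltrametricDist k → IsUltrametricDist E ∧ IsUltrametricDist F) ∧
    IsNuclearOperator T ∧ f = b.comp (T.comp a)

end NuclearMaps

section Spaces

variable (k : Type uk) [NontriviallyNormedField k]

/-- The topology of `V` is defined by its continuous admissible seminorms. -/
def IsLocallyConvex (V : Type u) [AddCommGroup V] [Module k V] [TopologicalSpace V] : Prop :=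
  ∀ U ∈ 𝓝 (0 : V), ∃ p : Seminorm k V, Continuous p ∧ p.IsAdmissible ∧ {x | p x < 1} ⊆ U

/-- Nuclearity of a locally convex space: every continuous admissible seminorm `p` is
dominated by a continuous admissible seminorm `q` such that the canonical map between the
completions is nuclear (`k` archimedean), respectively compact (`k` non-archimedean). -/
def IsNuclearSpace (V : Type u) [AddCommGroup V] [Module k V] [TopologicalSpace V] : Prop :=
  ∀ p : Seminorm k V, Continuous p → p.IsAdmissible →
    ∃ (q : Seminorm k V) (h : p ≤ q), Continuous q ∧ q.IsAdmissible ∧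
      (IsUltrametricDist k → IsCompactOperator (LocalBanach.link h)) ∧
      (¬ IsUltrametricDist k → IsNuclearOperator (LocalBanach.link h))

/-- Fréchet spaces: complete, metrizable (that is, Hausdorff and first countable) locally convex
topological vector spaces. -/
structure IsFrechet (V : Type u) [AddCommGroup V] [Module k V] [UniformSpace V] : Prop where
  uniformAddGroup : IsUniformAddGroup V
  continuousSMul : ContinuousSMul k V
  locallyConvex : IsLocallyConvex k V
  t2 : T2Space V
  firstCountable : FirstCountableTopology V
  complete : CompleteSpace V

/-- (FN)-spaces: nuclear Fréchet spaces. -/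
structure IsFN (V : Type u) [AddCommGroup V] [Module k V] [UniformSpace V] : Prop where
  frechet : IsFrechet k V
  nuclear : IsNuclearSpace k V

/-- (DFN)-spaces: the spaces topologically isomorphic to the strong dual of an (FN)-space.
`StrongDual` carries the topology of uniform convergence on bounded sets. -/
def IsDFN (W : Type v) [AddCommGroup W] [Module k W] [TopologicalSpace W] : Prop :=
  ∃ (U : Type w) (_ : AddCommGroup U) (_ : Module k U) (_ : UniformSpace U),
    IsFN k U ∧ Nonempty (W ≃L[k] StrongDual k U)

end Spaces

/-! Write W = U' with U an (FN)-space. A map f : V → U' is a bilinear form on V × U. Both spaces are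
first countable and null sequences are bounded, so the form is jointly continuous
(`exists_nhds_norm_apply_le_one`) and f factors through the completion of V for some seminorm p,
followed by a map into the dual of (U, r). Inserting a nuclear link from the completion for some q ≥
p makes f nuclear. In the ultrametric case the links are only assumed compact;
`IsCompactOperator.isNuclearOperator` turns compactness into nuclearity by an orthogonalization
argument.

For g : U' → V, the countably many seminorms pulled back from V are dominated, up to constants, by a
single continuous seminorm on U' (`IsFrechet.exists_seminorm_dominating`), so g factors through a
Banach space E. It remains to factor G : E → V through a nuclear operator E → F. Here F consists of
the v with sup c_m r_m(v) < ∞, where the r_m define the topology of V and the weights c_m > 0 are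
small (`exists_banach_of_seminorms`).

In the ultrametric case small weights make E → F compact: the tail of the supremum is uniformly
small, and the remaining seminorms are controlled by one compact link.

In the archimedean case the links yield finite rank operators P_n on V with r_n(x - P_n x) ≤ δ_n
r_{n+1}(x), whose nuclear cost is bounded independently of δ_n. Since P_{n+1} - P_n = (1 - P_n)
P_{n+1} - P_n (1 - P_{n+1}), both terms carry a factor δ. Hence G = P_0 G + ∑ (P_{n+1} - P_n) G
converges absolutely for every r_m, and suitable weights make the series nuclear into F. -/

/-! ### Ultrametric Hahn–Banach theorem over a locally compact field -/

section UltrametricHahnBanach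

variable {k : Type uk} [NontriviallyNormedField k] [IsUltrametricDist k] [ProperSpace k]
  {E : Type u} [AddCommGroup E] [Module k E]

/-- One-dimensional extension step of the ultrametric Hahn–Banach theorem: over a locally compact
ultrametric field, the closed balls constraining the new value have a common point. -/
theorem LinearPMap.exists_value_of_ultrametric (p : Seminorm k E)
    (hp : ∀ x y, p (x + y) ≤ max (p x) (p y)) {N : ℝ} (hN : 0 < N) (f : E →ₗ.[k] k)
    (hf : ∀ z : f.domain, ‖f z‖ * N ≤ p z) (y : E) :
    ∃ c : k, ∀ d : f.domain, ‖f d - c‖ * N ≤ p ((d : E) - y) := by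
  -- Ultrametric balls that meet are nested: the distance of the centres is at most the larger
  -- radius because p(d - d') ≤ max (p(d - y)) (p(d' - y)). Compactness then gives a common point.
  have hsub : ∀ d d' : f.domain, p ((d : E) - y) ≤ p ((d' : E) - y) →
      Metric.closedBall (f d) (p ((d : E) - y) / N) ⊆
        Metric.closedBall (f d') (p ((d' : E) - y) / N) := by
    intro d d' hdd z hz
    rw [Metric.mem_closedBall] at hz ⊢
    refine (dist_triangle_max z (f d) (f d')).trans (max_le (hz.trans (by gcongr)) ?_)
    rw [dist_eq_norm, ← LinearPMap.map_sub, le_div_iff₀ hN]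
    refine (hf _).trans ?_
    have h := hp ((d : E) - y) (-((d' : E) - y))
    rw [map_neg_eq_map, max_eq_right hdd] at h
    refine le_trans (le_of_eq ?_) h
    congr 1
    simp
  have hdir : Directed (· ⊇ ·)
      fun d : f.domain => Metric.closedBall (f d) (p ((d : E) - y) / N) := by
    intro d d'
    rcases le_total (p ((d : E) - y)) (p ((d' : E) - y)) with h | h
    · exact ⟨d, subset_rfl, hsub d d' h⟩
    · exact ⟨d', hsub d' d h, subset_rfl⟩
  obtain ⟨c, hc⟩ := IsCompact.nonempty_iInter_of_directed_nonempty_isCompact_isClosed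
    (fun d : f.domain => Metric.closedBall (f d) (p ((d : E) - y) / N)) hdir
    (fun d => ⟨f d, Metric.mem_closedBall_self (by positivity)⟩)
    (fun d => isCompact_closedBall _ _) (fun d => Metric.isClosed_closedBall)
  refine ⟨c, fun d => ?_⟩
  have := Set.mem_iInter.1 hc d
  rwa [Metric.mem_closedBall, dist_comm, dist_eq_norm, le_div_iff₀ hN] at this

/-- Ultrametric Hahn–Banach theorem over a locally compact field: every vector on which the
ultrametric seminorm `p` does not vanish is normed by a linear functional dominated by `p`. -/
theorem Seminorm.exists_dual_vector_of_ultrametric (p : Seminorm k E)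
    (hp : ∀ x y, p (x + y) ≤ max (p x) (p y)) {x : E} (hx : p x ≠ 0) :
    ∃ φ : E →ₗ[k] k, φ x = 1 ∧ ∀ z, ‖φ z‖ * p x ≤ p z := by
  have hN : 0 < p x := lt_of_le_of_ne (apply_nonneg p x) hx.symm
  have hx0 : x ≠ 0 := by rintro rfl; exact hx (map_zero p)
  set S : Set (E →ₗ.[k] k) := {f | ∀ z : f.domain, ‖f z‖ * p x ≤ p z} with hS
  let f₀ : E →ₗ.[k] k := LinearPMap.mkSpanSingleton x (1 : k) hx0
  have hf₀x : f₀ ⟨x, Submodule.mem_span_singleton_self x⟩ = 1 :=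
    LinearPMap.mkSpanSingleton_apply k k hx0 (1 : k)
  have hf₀ : f₀ ∈ S := by
    rintro ⟨z, hz⟩
    obtain ⟨t, rfl⟩ := Submodule.mem_span_singleton.1 hz
    have : f₀ ⟨t • x, hz⟩ = t • (1 : k) := by
      rw [← hf₀x, ← LinearPMap.map_smul]
      rfl
    rw [this, map_smul_eq_mul]
    simp
  have hSc : ∀ c, c ⊆ S → IsChain (· ≤ ·) c → ∀ y ∈ c, ∃ ub ∈ S, ∀ z ∈ c, z ≤ ub := by
    intro c hcs c_chain y hy
    have cne : c.Nonempty := ⟨y, hy⟩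
    have hcd : DirectedOn (· ≤ ·) c := c_chain.directedOn
    refine ⟨LinearPMap.sSup c hcd, ?_, fun _ ↦ LinearPMap.le_sSup hcd⟩
    rintro ⟨z, hz⟩
    have hdir : DirectedOn (· ≤ ·) (LinearPMap.domain '' c) :=
      directedOn_image.2 (hcd.mono LinearPMap.domain_mono.monotone)
    rcases (Submodule.mem_sSup_of_directed (cne.image _) hdir).1 hz with ⟨_, ⟨f, hfc, rfl⟩, hfx⟩
    have hle : f ≤ LinearPMap.sSup c hcd := LinearPMap.le_sSup _ hfc
    have h1 := hcs hfc ⟨z, hfx⟩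
    rwa [hle.2 (y := ⟨z, hz⟩) rfl] at h1
  obtain ⟨q, hpq, hqs, hq⟩ := zorn_le_nonempty₀ S hSc f₀ hf₀
  have htop : ∀ y, y ∈ q.domain := by
    intro y
    by_contra hy
    obtain ⟨c, hc⟩ := LinearPMap.exists_value_of_ultrametric p hp hN q hqs y
    have hr : q.supSpanSingleton y c hy ∈ S := by
      rintro ⟨z, hz⟩
      obtain ⟨d, hd, w, hw, rfl⟩ := Submodule.mem_sup.1 hz
      obtain ⟨t, rfl⟩ := Submodule.mem_span_singleton.1 hw
      rw [LinearPMap.supSpanSingleton_apply_mk _ _ _ _ _ hd]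
      rcases eq_or_ne t 0 with rfl | ht
      · simpa using hqs ⟨d, hd⟩
      -- Homogeneity reduces d + t y to the case of d' - y, with d' = -t⁻¹ d.
      · have h1 := hc ((-t⁻¹) • ⟨d, hd⟩)
        have h2 : q ⟨d, hd⟩ + t • c = (-t) • (q ((-t⁻¹) • ⟨d, hd⟩) - c) := by
          rw [LinearPMap.map_smul]
          simp only [smul_eq_mul]
          field_simp
          ring
        have h3 : d + t • y = (-t) • (((-t⁻¹) • (⟨d, hd⟩ : q.domain) : q.domain) - y) := by
          simp [smul_sub, smul_smul, ht]
        simp only [RingHom.id_apply]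
        rw [h2, h3, map_smul_eq_mul, norm_smul, mul_assoc]
        gcongr
    have hle : q ≤ q.supSpanSingleton y c hy := LinearPMap.left_le_sup _ _ _
    have h4 := (hq hr hle).1
    exact hy (h4 (show y ∈ (q.supSpanSingleton y c hy).domain from
      Submodule.mem_sup_right (Submodule.mem_span_singleton_self y)))
  refine ⟨q.toFun.comp (LinearMap.id.codRestrict q.domain htop), ?_, fun z => hqs ⟨z, htop z⟩⟩
  have h5 := hpq.2 (x := ⟨x, Submodule.mem_span_singleton_self x⟩) (y := ⟨x, htop x⟩) rfl
  exact h5.symm.trans hf₀x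

end UltrametricHahnBanach

/-! ### Compact operators are nuclear in the ultrametric case -/

section CompactOperators

variable {k : Type uk} [NontriviallyNormedField k]
  {E : Type u} [NormedAddCommGroup E] [NormedSpace k E]
  {F : Type v} [NormedAddCommGroup F] [NormedSpace k F]

/-- One step of the orthogonalization of a compact operator over a locally compact ultrametric
field: split off a rank one operator whose vector is the longest one in the image of the
unit ball. -/
theorem exists_rank_one_splitting [IsUltrametricDist k] [ProperSpace k] [IsUltrametricDist E]
    [IsUltrametricDist F] {K : Set F} (hK : IsCompact K) (S : E →L[k] F)
    (hS : ∀ z, ‖z‖ ≤ 1 → S z ∈ K) :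
    ∃ (φ : StrongDual k E) (y : F), (∃ x, ‖x‖ ≤ 1 ∧ S x = y) ∧
      (∀ z, ‖z‖ ≤ 1 → ‖S z‖ ≤ ‖y‖) ∧ (∀ z, ‖φ z‖ * ‖y‖ ≤ ‖S z‖) ∧
      (∀ z, ∃ w, (‖z‖ ≤ 1 → ‖w‖ ≤ 1) ∧ S z - φ z • y = S w) ∧
      ∀ z, ‖y‖ ≤ ‖y - (S z - φ z • y)‖ := by
  -- The image of the unit ball need not be closed, but its closure has a longest vector m. If m ≠
  -- 0, any S x closer to m than ‖m‖ has norm at least ‖m‖ by the strong triangle inequality.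
  have hmax : ∃ x, ‖x‖ ≤ 1 ∧ ∀ z, ‖z‖ ≤ 1 → ‖S z‖ ≤ ‖S x‖ := by
    set A : Set F := S '' Metric.closedBall 0 1 with hA
    have hAK : closure A ⊆ K := by
      refine closure_minimal ?_ hK.isClosed
      rintro _ ⟨z, hz, rfl⟩
      exact hS z (by simpa using hz)
    have hAc : IsCompact (closure A) := hK.of_isClosed_subset isClosed_closure hAK
    have hmem : ∀ z, ‖z‖ ≤ 1 → S z ∈ closure A := fun z hz =>
      subset_closure ⟨z, by simpa using hz, rfl⟩
    obtain ⟨m, hm, hmax⟩ := hAc.exists_isMaxOn ⟨S 0, hmem 0 (by simp)⟩ continuous_norm.continuousOn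
    rcases eq_or_ne m 0 with rfl | hm0
    · exact ⟨0, by simp, fun z hz => by simpa using hmax (hmem z hz)⟩
    · obtain ⟨_, ⟨x, hx, rfl⟩, hd⟩ := Metric.mem_closure_iff.1 hm ‖m‖ (norm_pos_iff.2 hm0)
      have hSx : ‖m‖ ≤ ‖S x‖ := by
        by_contra! hlt
        have h := IsUltrametricDist.norm_add_le_max (m - S x) (S x)
        rw [sub_add_cancel] at h
        rw [dist_eq_norm] at hd
        exact absurd h (not_le.2 (max_lt hd hlt))
      exact ⟨x, by simpa using hx, fun z hz => (hmax (hmem z hz)).trans hSx⟩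
  obtain ⟨x, hx1, hx⟩ := hmax
  rcases eq_or_ne (S x) 0 with h0 | h0
  · exact ⟨0, S x, ⟨x, hx1, rfl⟩, hx, by simp, fun z => ⟨z, id, by simp⟩, by simp [h0]⟩
  -- Hahn–Banach is applied on E to z ↦ ‖S z‖. As |φ(z)| ≤ 1 on the unit ball, z - φ(z) x stays in
  -- that ball, so the residual S z - φ(z) S x = S (z - φ(z) x) takes values in the same compact
  -- set.
  let p : Seminorm k E := (normSeminorm k F).comp (S : E →ₗ[k] F)
  have hpa : ∀ z, p z = ‖S z‖ := fun z => rfl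
  obtain ⟨φ, hφx, hφ⟩ := p.exists_dual_vector_of_ultrametric (x := x)
    (fun a b => by rw [hpa, hpa, hpa, map_add]; exact IsUltrametricDist.norm_add_le_max _ _)
    (by rw [hpa]; exact norm_ne_zero_iff.2 h0)
  have hpos : 0 < ‖S x‖ := norm_pos_iff.2 h0
  simp only [hpa] at hφ
  let Φ : StrongDual k E := φ.mkContinuous (‖S‖ / ‖S x‖) fun z => by
    rw [div_mul_eq_mul_div, le_div_iff₀ hpos]
    exact (hφ z).trans (S.le_opNorm z)
  have hΦ : ∀ z, Φ z = φ z := fun z => rfl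
  refine ⟨Φ, S x, ⟨x, hx1, rfl⟩, hx, hφ, fun z => ⟨z - φ z • x, fun hz => ?_, ?_⟩, fun z => ?_⟩
  · have h1 : ‖φ z‖ ≤ 1 := by
      have := (hφ z).trans (hx z hz)
      nlinarith
    rw [sub_eq_add_neg]
    refine (IsUltrametricDist.norm_add_le_max _ _).trans (max_le hz ?_)
    rw [norm_neg, norm_smul]
    exact mul_le_one₀ h1 (norm_nonneg _) hx1
  · rw [hΦ, map_sub, map_smul]
  -- Separation: φ kills z - φ(z) x and φ(x) = 1, so φ takes the value 1 on the difference.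
  · have h1 : S x - (S z - Φ z • S x) = S (x - (z - φ z • x)) := by
      rw [hΦ, map_sub, map_sub, map_smul]
    have h2 := hφ (x - (z - φ z • x))
    rw [map_sub, map_sub, map_smul, hφx] at h2
    rw [h1]
    simpa using h2

/-- Over a locally compact ultrametric field, compact operators between ultrametric Banach spaces
are nuclear. -/
theorem IsCompactOperator.isNuclearOperator [IsUltrametricDist k] [ProperSpace k]
    [IsUltrametricDist E] [IsUltrametricDist F] [CompleteSpace F] {T : E →L[k] F}
    (hT : IsCompactOperator T) : IsNuclearOperator T := by
  obtain ⟨K, hK, hTK⟩ := IsCompactOperator.image_closedBall_subset_compact (𝕜₁ := k)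
    (f := (T : E →ₗ[k] F)) hT 1
  have hTK' : ∀ z, ‖z‖ ≤ 1 → T z ∈ K := fun z hz => hTK ⟨z, by simpa using hz, rfl⟩
  have hstep := fun S : {S : E →L[k] F // ∀ z, ‖z‖ ≤ 1 → S z ∈ K} =>
    exists_rank_one_splitting hK S.1 S.2
  choose φ y hyim hybd hφ hres hsep using hstep
  let next : {S : E →L[k] F // ∀ z, ‖z‖ ≤ 1 → S z ∈ K} →
      {S : E →L[k] F // ∀ z, ‖z‖ ≤ 1 → S z ∈ K} := fun S =>
    ⟨S.1 - (φ S).smulRight (y S), fun z hz => by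
      obtain ⟨w, hw, he⟩ := hres S z
      have : (S.1 - (φ S).smulRight (y S)) z = S.1 w := by simpa using he
      rw [this]
      exact S.2 w (hw hz)⟩
  have hnext : ∀ S z, (next S).1 z = S.1 z - φ S z • y S := fun S z => by simp [next]
  let R : ℕ → {S : E →L[k] F // ∀ z, ‖z‖ ≤ 1 → S z ∈ K} := fun n => next^[n] ⟨T, hTK'⟩
  have hR0 : (R 0).1 = T := rfl
  have hRs : ∀ n, R (n + 1) = next (R n) := fun n => Function.iterate_succ_apply' _ _ _
  have hRsub : ∀ n m, n ≤ m → ∀ z, ∃ w, (R m).1 z = (R n).1 w := by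
    intro n m hnm
    induction m, hnm using Nat.le_induction with
    | base => exact fun z => ⟨z, rfl⟩
    | succ m hm ih =>
      intro z
      obtain ⟨w, -, hw⟩ := hres (R m) z
      obtain ⟨w', hw'⟩ := ih w
      exact ⟨w', by rw [hRs, hnext, hw, hw']⟩
  have hanti : Antitone fun n => ‖y (R n)‖ := by
    refine antitone_nat_of_succ_le fun n => ?_
    obtain ⟨x, hx, he⟩ := hyim (R (n + 1))
    obtain ⟨w, hw, he'⟩ := hres (R n) x
    rw [← he, hRs, hnext, he']
    exact hybd _ w (hw hx)
  have hyK : ∀ n, y (R n) ∈ K := fun n => by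
    obtain ⟨x, hx, he⟩ := hyim (R n)
    exact he ▸ (R n).2 x hx
  -- Each vector is at distance at least its own length from all later ones. A convergent
  -- subsequence in K therefore forces the decreasing lengths to tend to 0.
  have hdist : ∀ n m, n < m → ‖y (R n)‖ ≤ dist (y (R n)) (y (R m)) := by
    intro n m hnm
    obtain ⟨x, -, hx⟩ := hyim (R m)
    obtain ⟨w, hw⟩ := hRsub (n + 1) m hnm x
    rw [dist_eq_norm, ← hx, hw, hRs, hnext]
    exact hsep _ _
  have hy0 : Tendsto (fun n => ‖y (R n)‖) atTop (𝓝 0) := by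
    obtain ⟨a, -, s, hs, ha⟩ := hK.tendsto_subseq hyK
    rw [Metric.tendsto_atTop]
    intro ε hε
    obtain ⟨N, hN⟩ := Metric.cauchySeq_iff.1 ha.cauchySeq ε hε
    refine ⟨s N, fun n hn => ?_⟩
    rw [dist_zero_right, norm_norm]
    exact (hanti hn).trans_lt ((hdist _ _ (hs (Nat.lt_succ_self N))).trans_lt
      (hN N le_rfl (N + 1) (Nat.le_succ N)))
  obtain ⟨c, hc⟩ := NormedField.exists_one_lt_norm k
  -- The norm of E need not take its values in the value group of k, so rescaling into the unit ball
  -- costs a factor ‖c‖.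
  have hbound : ∀ n z, ‖(R n).1 z‖ ≤ ‖c‖ * ‖y (R n)‖ * ‖z‖ := by
    intro n z
    rcases eq_or_ne z 0 with rfl | hz
    · simp
    obtain ⟨d, hd, hlt, -, hinv⟩ := rescale_to_shell hc one_pos hz
    have h1 := hybd (R n) (d • z) hlt.le
    rw [map_smul, norm_smul] at h1
    have hd' : 0 < ‖d‖ := norm_pos_iff.2 hd
    have h2 : ‖(R n).1 z‖ ≤ ‖d‖⁻¹ * ‖y (R n)‖ := by
      rw [← div_eq_inv_mul, le_div_iff₀ hd', mul_comm]
      exact h1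
    refine h2.trans ?_
    rw [mul_right_comm]
    gcongr
    simpa using hinv
  have hsum : ∀ n z, T z = ∑ i ∈ Finset.range n, φ (R i) z • y (R i) + (R n).1 z := by
    intro n z
    induction n with
    | zero => simp [hR0]
    | succ n ih => rw [Finset.sum_range_succ, hRs, hnext, ih]; abel
  have hφy : Tendsto (fun n => ‖φ (R n)‖ * ‖y (R n)‖) atTop (𝓝 0) := by
    refine squeeze_zero (fun n => by positivity) (fun n => ?_) (by simpa using hy0.const_mul ‖c‖)
    rcases (norm_nonneg (y (R n))).eq_or_lt with h | h
    · simp [← h]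
    rw [← le_div_iff₀ h]
    refine ContinuousLinearMap.opNorm_le_bound _ (by positivity) fun z => ?_
    rw [div_mul_eq_mul_div, le_div_iff₀ h]
    exact (hφ _ z).trans (hbound n z)
  refine ⟨fun n => φ (R n), fun n => y (R n), fun _ => hφy, fun h => (h ‹_›).elim, fun z => ?_⟩
  have hterm : Tendsto (fun n => φ (R n) z • y (R n)) atTop (𝓝 0) := by
    refine squeeze_zero_norm (fun n => ?_) (by simpa using hφy.mul_const ‖z‖)
    rw [norm_smul, mul_right_comm]
    gcongr
    exact (φ (R n)).le_opNorm z
  have hS : Summable fun n => φ (R n) z • y (R n) :=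
    NonarchimedeanAddGroup.summable_of_tendsto_cofinite_zero (by rwa [Nat.cofinite_eq_atTop])
  have hR : Tendsto (fun n => (R n).1 z) atTop (𝓝 0) :=
    squeeze_zero_norm (hbound · z) (by simpa using (hy0.const_mul ‖c‖).mul_const ‖z‖)
  have hlim : Tendsto (fun n => ∑ i ∈ Finset.range n, φ (R i) z • y (R i)) atTop (𝓝 (T z)) := by
    have := (tendsto_const_nhds (x := T z)).sub hR
    rw [sub_zero] at this
    refine this.congr fun n => ?_
    rw [hsum n z]
    abel
  rw [← tendsto_nhds_unique hS.hasSum.tendsto_sum_nat hlim]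
  exact hS.hasSum

/-- Nuclear operators are stable under composition on the left. -/
theorem IsNuclearOperator.clm_comp {G : Type w} [NormedAddCommGroup G] [NormedSpace k G]
    {T : E →L[k] F} (hT : IsNuclearOperator T) (S : F →L[k] G) :
    IsNuclearOperator (S.comp T) := by
  obtain ⟨φ, y, h1, h2, h3⟩ := hT
  have hle : ∀ n, ‖φ n‖ * ‖S (y n)‖ ≤ ‖S‖ * (‖φ n‖ * ‖y n‖) := fun n => by
    rw [mul_left_comm]
    gcongr
    exact S.le_opNorm _
  refine ⟨φ, fun n => S (y n), fun h => ?_, fun h => ?_, fun x => ?_⟩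
  · exact squeeze_zero (fun n => by positivity) hle (by simpa using (h1 h).const_mul ‖S‖)
  · exact Summable.of_nonneg_of_le (fun n => by positivity) hle ((h2 h).mul_left ‖S‖)
  · simpa using (h3 x).mapL S

end CompactOperators

/-! ### Seminormed spaces and their completions -/

section SeminormSpaces

variable {k : Type uk} [NontriviallyNormedField k] {E : Type u} [AddCommGroup E] [Module k E]

/-- A seminorm bounded by `M` on the unit ball of `q` is bounded by a multiple of `q`. -/
theorem Seminorm.le_mul_of_le_on_ball (p q : Seminorm k E) {c : k} (hc : 1 < ‖c‖) {M : ℝ}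
    (h : ∀ x, q x < 1 → p x ≤ M) (x : E) : p x ≤ ‖c‖ * M * q x := by
  have hM : 0 ≤ M := by simpa using h 0 (by simp)
  rcases eq_or_ne (q x) 0 with hx | hx
  · rw [hx, mul_zero]
    by_contra! hpos
    -- When q vanishes at x, all multiples of x lie in the unit ball of q, so p(x) > 0 would make p
    -- unbounded there.
    obtain ⟨t, ht⟩ := NormedField.exists_lt_norm k (M / p x)
    rw [div_lt_iff₀ hpos] at ht
    have := h (t • x) (by rw [map_smul_eq_mul, hx, mul_zero]; exact one_pos)
    rw [map_smul_eq_mul] at this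
    exact absurd this (not_le.2 ht)
  · obtain ⟨d, hd, hlt, -, hinv⟩ := q.rescale_to_shell hc one_pos hx
    have hd' : 0 < ‖d‖ := norm_pos_iff.2 hd
    have h1 := h (d • x) hlt
    rw [map_smul_eq_mul] at h1
    have h2 : p x ≤ ‖d‖⁻¹ * M := by
      rw [← div_eq_inv_mul, le_div_iff₀ hd', mul_comm]
      exact h1
    refine h2.trans ?_
    rw [mul_right_comm]
    gcongr
    simpa using hinv

/-- The identity of `E`, with values in `E` endowed with the seminorm `p`. -/
def SeminormSpace.of (p : Seminorm k E) : E →ₗ[k] SeminormSpace p where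
  toFun x := x
  map_add' _ _ := rfl
  map_smul' _ _ := rfl

/-- The identity from `E` endowed with the seminorm `p` to `E`. -/
def SeminormSpace.toBase (p : Seminorm k E) : SeminormSpace p →ₗ[k] E where
  toFun x := x
  map_add' _ _ := rfl
  map_smul' _ _ := rfl

@[simp]
theorem SeminormSpace.norm_of (p : Seminorm k E) (x : E) : ‖SeminormSpace.of p x‖ = p x := rfl

theorem SeminormSpace.norm_eq (p : Seminorm k E) (x : SeminormSpace p) :
    ‖x‖ = p (SeminormSpace.toBase p x) := rfl

@[simp]
theorem SeminormSpace.toBase_of (p : Seminorm k E) (x : E) :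
    SeminormSpace.toBase p (SeminormSpace.of p x) = x := rfl

@[simp]
theorem SeminormSpace.of_toBase (p : Seminorm k E) (x : SeminormSpace p) :
    SeminormSpace.of p (SeminormSpace.toBase p x) = x := rfl

theorem LocalBanach.isUltrametricDist [IsUltrametricDist k] {p : Seminorm k E}
    (hp : p.IsAdmissible) : IsUltrametricDist (LocalBanach p) := by
  refine IsUltrametricDist.isUltrametricDist_of_forall_norm_add_le_max_norm fun x y => ?_
  induction x, y using UniformSpace.Completion.induction_on₂ with
  | hp => exact isClosed_le (by fun_prop) (by fun_prop)
  | ih a b =>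
    rw [← UniformSpace.Completion.coe_add]
    simp only [UniformSpace.Completion.norm_coe]
    exact hp ‹_› (SeminormSpace.toBase p a) (SeminormSpace.toBase p b)

section Topology

variable [TopologicalSpace E] [IsTopologicalAddGroup E]

/-- The identity of `E` as a continuous linear map to `E` endowed with the continuous
seminorm `p`. -/
def SeminormSpace.ofL (p : Seminorm k E) (hp : Continuous p) : E →L[k] SeminormSpace p where
  toLinearMap := SeminormSpace.of p
  cont := by
    refine continuous_of_continuousAt_zero (SeminormSpace.of p) ?_
    rw [ContinuousAt, map_zero, tendsto_zero_iff_norm_tendsto_zero]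
    have := hp.tendsto 0
    rwa [map_zero] at this

@[simp]
theorem SeminormSpace.ofL_apply (p : Seminorm k E) (hp : Continuous p) (x : E) :
    SeminormSpace.ofL p hp x = SeminormSpace.of p x := rfl

/-- The canonical map from `E` to its completion with respect to a continuous seminorm. -/
noncomputable def LocalBanach.mk (p : Seminorm k E) (hp : Continuous p) : E →L[k] LocalBanach p :=
  UniformSpace.Completion.toComplL.comp (SeminormSpace.ofL p hp)

theorem LocalBanach.mk_apply (p : Seminorm k E) (hp : Continuous p) (x : E) :
    LocalBanach.mk p hp x = ((SeminormSpace.of p x : SeminormSpace p) : LocalBanach p) := rfl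

@[simp]
theorem LocalBanach.norm_mk (p : Seminorm k E) (hp : Continuous p) (x : E) :
    ‖LocalBanach.mk p hp x‖ = p x := by
  rw [LocalBanach.mk_apply, UniformSpace.Completion.norm_coe, SeminormSpace.norm_of]

theorem LocalBanach.link_mk {p q : Seminorm k E} (h : p ≤ q) (hp : Continuous p)
    (hq : Continuous q) (x : E) :
    LocalBanach.link h (LocalBanach.mk q hq x) = LocalBanach.mk p hp x := by
  rw [LocalBanach.mk_apply, LocalBanach.mk_apply, LocalBanach.link,
    ContinuousLinearMap.completion_apply_coe]
  rfl

theorem LocalBanach.denseRange_mk (p : Seminorm k E) (hp : Continuous p) :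
    DenseRange (LocalBanach.mk p hp) := by
  intro z
  refine closure_mono ?_ (UniformSpace.Completion.denseRange_coe z)
  rintro _ ⟨x, rfl⟩
  exact ⟨SeminormSpace.toBase p x, rfl⟩

/-- A linear map which is continuous for the seminorm `p` extends to the completion. -/
theorem LocalBanach.exists_extension {H : Type v} [AddCommGroup H] [Module k H] [UniformSpace H]
    [IsUniformAddGroup H] [ContinuousConstSMul k H] [T0Space H] [CompleteSpace H]
    (p : Seminorm k E) (hp : Continuous p) (f : SeminormSpace p →L[k] H) :
    ∃ g : LocalBanach p →L[k] H, ∀ x, g (LocalBanach.mk p hp x) = f (SeminormSpace.of p x) :=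
  ⟨f.extend UniformSpace.Completion.toComplL, fun x =>
    ContinuousLinearMap.extend_eq f UniformSpace.Completion.denseRange_coe
      (UniformSpace.Completion.isUniformInducing_coe _) (SeminormSpace.of p x)⟩

end Topology

end SeminormSpaces

/-! ### Universe change and ultrametric norms -/

section Shrink

variable {k : Type uk} [NontriviallyNormedField k]

/-- A Banach space embedding linearly into a type of another universe has a linearly isometric copy
there. -/
theorem exists_linearIsometryEquiv_of_small (G : Type w) [NormedAddCommGroup G] [NormedSpace k G]
    [Small.{v} G] :
    ∃ (F : Type v) (_ : NormedAddCommGroup F) (_ : NormedSpace k F), Nonempty (G ≃ₗᵢ[k] F) := by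
  refine ⟨Shrink.{v} G, inferInstance, inferInstance, ⟨LinearIsometryEquiv.symm ?_⟩⟩
  exact
    { Shrink.linearEquiv k G with
      norm_map' := fun x => rfl }

theorem LinearIsometryEquiv.isUltrametricDist {G : Type w} {F : Type v} [NormedAddCommGroup G]
    [NormedSpace k G] [NormedAddCommGroup F] [NormedSpace k F] (e : G ≃ₗᵢ[k] F)
    [IsUltrametricDist G] : IsUltrametricDist F :=
  IsUltrametricDist.isUltrametricDist_of_forall_norm_add_le_max_norm fun x y => by
    rw [← e.symm.norm_map (x + y), ← e.symm.norm_map x, ← e.symm.norm_map y, map_add]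
    exact IsUltrametricDist.norm_add_le_max _ _

theorem StrongDual.isUltrametricDist [IsUltrametricDist k] (G : Type w) [SeminormedAddCommGroup G]
    [NormedSpace k G] : IsUltrametricDist (StrongDual k G) :=
  IsUltrametricDist.isUltrametricDist_of_forall_norm_add_le_max_norm fun φ ψ => by
    refine ContinuousLinearMap.opNorm_le_bound _ (by positivity) fun x => ?_
    refine (IsUltrametricDist.norm_add_le_max (φ x) (ψ x)).trans (max_le ?_ ?_)
    · exact (φ.le_opNorm x).trans (by gcongr; exact le_max_left _ _)
    · exact (ψ.le_opNorm x).trans (by gcongr; exact le_max_right _ _)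

end Shrink

/-! ### Maps from V to the strong dual of U -/

section MapsToDual

variable {k : Type uk} [NontriviallyNormedField k] {V : Type u} [AddCommGroup V] [Module k V]
  {U : Type w} [AddCommGroup U] [Module k U]

/-- A continuous linear map from a first countable space to the strong dual of a first
countable space defines a jointly continuous bilinear form. -/
theorem exists_nhds_norm_apply_le_one [TopologicalSpace V] [FirstCountableTopology V]
    [UniformSpace U] [IsUniformAddGroup U] [ContinuousSMul k U] [FirstCountableTopology U]
    (f : V →L[k] StrongDual k U) :
    ∃ A ∈ 𝓝 (0 : V), ∃ B ∈ 𝓝 (0 : U), ∀ x ∈ A, ∀ y ∈ B, ‖f x y‖ ≤ 1 := by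
  obtain ⟨A, hA⟩ := (𝓝 (0 : V)).exists_antitone_basis
  obtain ⟨B, hB⟩ := (𝓝 (0 : U)).exists_antitone_basis
  by_contra! hcon
  choose x hx y hy hxy using fun n =>
    hcon (A n) (hA.1.mem_of_mem trivial) (B n) (hB.1.mem_of_mem trivial)
  have hx0 : Tendsto x atTop (𝓝 0) := hA.tendsto hx
  have hy0 : Tendsto y atTop (𝓝 0) := hB.tendsto hy
  -- The null sequence y is bounded, so f (x n) → 0 holds uniformly on its range, contradicting ‖f
  -- (x n) (y n)‖ > 1.
  have hbd := hy0.isVonNBounded_range k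
  have hmem : {φ : StrongDual k U | ∀ u ∈ Set.range y, φ u ∈ Metric.ball (0 : k) 1} ∈
      𝓝 (0 : StrongDual k U) :=
    ContinuousLinearMap.hasBasis_nhds_zero.mem_of_mem (i := (Set.range y, Metric.ball (0 : k) 1))
      ⟨hbd, Metric.ball_mem_nhds _ one_pos⟩
  have hf0 : Tendsto (fun n => f (x n)) atTop (𝓝 0) := by
    have := (f.continuous.tendsto 0).comp hx0
    rwa [map_zero] at this
  obtain ⟨n, hn⟩ := (hf0.eventually_mem hmem).exists
  have := hn (y n) ⟨n, rfl⟩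
  rw [mem_ball_zero_iff] at this
  exact absurd this (not_lt.2 (hxy n).le)

/-- A continuous linear map between a metrizable locally convex space and the strong dual of
such a space is bounded by a product of continuous seminorms. -/
theorem exists_seminorms_norm_apply_le [UniformSpace V] [UniformSpace U] (hV : IsFrechet k V)
    (hU : IsFrechet k U) (f : V →L[k] StrongDual k U) :
    ∃ (p : Seminorm k V) (r : Seminorm k U) (C : ℝ), Continuous p ∧ p.IsAdmissible ∧
      Continuous r ∧ r.IsAdmissible ∧ ∀ x y, ‖f x y‖ ≤ C * p x * r y := by
  have := hV.firstCountable
  have := hU.firstCountable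
  have := hU.uniformAddGroup
  have := hU.continuousSMul
  obtain ⟨A, hA, B, hB, hAB⟩ := exists_nhds_norm_apply_le_one f
  obtain ⟨p, hpc, hpa, hpA⟩ := hV.locallyConvex A hA
  obtain ⟨r, hrc, hra, hrB⟩ := hU.locallyConvex B hB
  obtain ⟨c, hc⟩ := NormedField.exists_one_lt_norm k
  refine ⟨p, r, ‖c‖ * ‖c‖, hpc, hpa, hrc, hra, fun x y => ?_⟩
  -- Homogenize first in y and then in x; each step costs a factor ‖c‖.
  have h1 : ∀ x, p x < 1 → ∀ y, ‖f x y‖ ≤ ‖c‖ * 1 * r y := fun x hx y =>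
    ((normSeminorm k k).comp ((f x : U →L[k] k) : U →ₗ[k] k)).le_mul_of_le_on_ball r hc
      (fun y hy => hAB x (hpA hx) y (hrB hy)) y
  let g : V →ₗ[k] k :=
    { toFun := fun x => f x y
      map_add' := fun a b => by simp
      map_smul' := fun a b => by simp }
  have h2 := ((normSeminorm k k).comp g).le_mul_of_le_on_ball p hc (fun x hx => h1 x hx y) x
  refine h2.trans (le_of_eq ?_)
  ring

/-- Every continuous linear map from a Fréchet space whose local Banach spaces are linked by
nuclear operators to the strong dual of a Fréchet space is nuclear. -/
theorem isNuclearMap_of_nuclear_links [CompleteSpace k] [UniformSpace V] [UniformSpace U]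
    (hV : IsFrechet k V) (hU : IsFrechet k U)
    (hlink : ∀ p : Seminorm k V, Continuous p → p.IsAdmissible →
      ∃ (q : Seminorm k V) (h : p ≤ q), Continuous q ∧ q.IsAdmissible ∧
        IsNuclearOperator (LocalBanach.link h))
    {W : Type v} [AddCommGroup W] [Module k W] [TopologicalSpace W] (e : W ≃L[k] StrongDual k U)
    (f : V →L[k] W) : IsNuclearMap f := by
  have := hV.uniformAddGroup
  have := hU.uniformAddGroup
  have := hU.continuousSMul
  obtain ⟨p, r, C, hpc, hpa, hrc, hra, hC⟩ :=
    exists_seminorms_norm_apply_le hV hU ((e : W →L[k] StrongDual k U).comp f)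
  obtain ⟨q, hpq, hqc, hqa, hnuc⟩ := hlink p hpc hpa
  let b : StrongDual k (SeminormSpace r) →L[k] W :=
    (e.symm : StrongDual k U →L[k] W).comp
      (ContinuousLinearMap.precomp k (SeminormSpace.ofL r hrc))
  have hb : ∀ ψ u, e (b ψ) u = ψ (SeminormSpace.of r u) := fun ψ u => by
    simp [b]
  have hbinj : Function.Injective b := fun ψ ψ' h => by
    ext u
    have h1 := hb ψ (SeminormSpace.toBase r u)
    rw [h, hb] at h1
    simpa using h1.symm
  let _ : NormedAddCommGroup (StrongDual k (SeminormSpace r)) :=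
    NormedAddCommGroup.ofSeparation fun φ hφ => by
      ext y
      simpa [hφ] using φ.le_opNorm y
  -- `IsNuclearMap` asks for a Banach space in the universe of W; the injection b into W provides a
  -- copy there.
  have : Small.{v} (StrongDual k (SeminormSpace r)) := small_of_injective hbinj
  obtain ⟨F, _, _, ⟨j⟩⟩ :=
    exists_linearIsometryEquiv_of_small.{uk, v} (k := k) (StrongDual k (SeminormSpace r))
  let B : SeminormSpace p →ₗ[k] SeminormSpace r →ₗ[k] k :=
    LinearMap.mk₂ k (fun x y => e (f (SeminormSpace.toBase p x)) (SeminormSpace.toBase r y))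
      (fun _ _ _ => by simp) (fun _ _ _ => by simp) (fun _ _ _ => by simp) (fun _ _ _ => by simp)
  let S : SeminormSpace p →L[k] StrongDual k (SeminormSpace r) :=
    LinearMap.mkContinuous₂ B C fun x y => by
      rw [SeminormSpace.norm_eq, SeminormSpace.norm_eq]
      exact hC _ _
  obtain ⟨g, hg⟩ := LocalBanach.exists_extension p hpc S
  refine ⟨LocalBanach q, inferInstance, inferInstance, F, ‹_›, ‹_›, LocalBanach.mk q hqc,
    ((j : StrongDual k (SeminormSpace r) →L[k] F).comp g).comp (LocalBanach.link hpq),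
    b.comp (j.symm : F →L[k] StrongDual k (SeminormSpace r)), inferInstance, ?_, fun hk => ?_,
    hnuc.clm_comp _, ?_⟩
  · exact (completeSpace_congr (e := j.toEquiv)
      j.toContinuousLinearEquiv.isUniformEmbedding).1 inferInstance
  · have := StrongDual.isUltrametricDist (k := k) (SeminormSpace r)
    exact ⟨LocalBanach.isUltrametricDist hqa, j.isUltrametricDist⟩
  · ext x
    apply e.injective
    ext u
    simp only [ContinuousLinearMap.comp_apply]
    rw [LocalBanach.link_mk hpq hpc hqc, hg]
    simp [hb, S, B]

end MapsToDual

/-! ### Defining sequences of seminorms and countable domination -/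

section Frechet

variable {k : Type uk} [NontriviallyNormedField k] {V : Type u} [AddCommGroup V] [Module k V]

theorem Seminorm.IsAdmissible.sup {p q : Seminorm k V} (hp : p.IsAdmissible)
    (hq : q.IsAdmissible) : (p ⊔ q).IsAdmissible := fun hk x y => by
  simp only [Seminorm.sup_apply]
  refine max_le ((hp hk x y).trans ?_) ((hq hk x y).trans ?_)
  · exact max_le_max (le_max_left _ _) (le_max_left _ _)
  · exact max_le_max (le_max_right _ _) (le_max_right _ _)

theorem Seminorm.continuous_sup [TopologicalSpace V] {p q : Seminorm k V} (hp : Continuous p)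
    (hq : Continuous q) : Continuous (p ⊔ q) :=
  (hp.max hq).congr fun _ => rfl

/-- The topology of a Fréchet space is defined by an increasing sequence of seminorms, each of
which may be required to be large compared to the previous one. -/
theorem IsFrechet.exists_seminorm_chain [UniformSpace V] (hV : IsFrechet k V)
    (R : Seminorm k V → Seminorm k V → Prop) (hR : ∀ p q q', R p q → q ≤ q' → R p q')
    (hstep : ∀ p : Seminorm k V, Continuous p → p.IsAdmissible →
      ∃ q : Seminorm k V, p ≤ q ∧ Continuous q ∧ q.IsAdmissible ∧ R p q) :
    ∃ r : ℕ → Seminorm k V, Monotone r ∧ (∀ n, Continuous (r n)) ∧ (∀ n, (r n).IsAdmissible) ∧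
      (∀ n, R (r n) (r (n + 1))) ∧ ∀ X ∈ 𝓝 (0 : V), ∃ n, {x | r n x < 1} ⊆ X := by
  have := hV.firstCountable
  obtain ⟨A, hA⟩ := (𝓝 (0 : V)).exists_antitone_basis
  choose s hsc hsa hs using fun n => hV.locallyConvex (A n) (hA.1.mem_of_mem trivial)
  have hstep' : ∀ p : {p : Seminorm k V // Continuous p ∧ p.IsAdmissible},
      ∃ q : {p : Seminorm k V // Continuous p ∧ p.IsAdmissible}, p.1 ≤ q.1 ∧ R p.1 q.1 := by
    rintro ⟨p, hp, hp'⟩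
    obtain ⟨q, h1, h2, h3, h4⟩ := hstep p hp hp'
    exact ⟨⟨q, h2, h3⟩, h1, h4⟩
  choose q hle hRq using hstep'
  let r : ℕ → {p : Seminorm k V // Continuous p ∧ p.IsAdmissible} := fun n =>
    Nat.rec ⟨s 0, hsc 0, hsa 0⟩ (fun n p => ⟨(q p).1 ⊔ s (n + 1),
      Seminorm.continuous_sup (q p).2.1 (hsc _), (q p).2.2.sup (hsa _)⟩) n
  have hr : ∀ n, (r (n + 1)).1 = (q (r n)).1 ⊔ s (n + 1) := fun n => rfl
  refine ⟨fun n => (r n).1, monotone_nat_of_le_succ fun n => ?_, fun n => (r n).2.1,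
    fun n => (r n).2.2, fun n => ?_, fun X hX => ?_⟩
  · rw [hr]
    exact (hle _).trans le_sup_left
  · beta_reduce
    rw [hr]
    exact hR _ _ _ (hRq _) le_sup_left
  · obtain ⟨n, -, hn⟩ := hA.1.mem_iff.1 hX
    refine ⟨n, fun x hx => hn (hs n ?_)⟩
    refine lt_of_le_of_lt ?_ (show (r n).1 x < 1 from hx)
    cases n with
    | zero => exact le_rfl
    | succ n => exact (le_sup_right : s (n + 1) ≤ (q (r n)).1 ⊔ s (n + 1)) x

theorem Bornology.IsVonNBounded.exists_seminorm_le [TopologicalSpace V] {D : Set V}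
    (hD : Bornology.IsVonNBounded k D) {r : Seminorm k V} (hr : Continuous r) :
    ∃ M : ℝ, ∀ x ∈ D, r x ≤ M := by
  have hX : {x | r x < 1} ∈ 𝓝 (0 : V) :=
    (isOpen_lt hr continuous_const).mem_nhds (by simp)
  obtain ⟨a, ha⟩ := (hD hX).exists
  refine ⟨‖a‖, fun x hx => ?_⟩
  obtain ⟨y, hy, rfl⟩ := ha hx
  simp only [map_smul_eq_mul]
  exact mul_le_of_le_one_right (norm_nonneg _) (le_of_lt hy)

/-- The Mackey countability condition in a Fréchet space, dualized: countably many continuous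
seminorms on the strong dual are dominated by multiples of a single one. -/
theorem IsFrechet.exists_seminorm_dominating [UniformSpace V] (hV : IsFrechet k V)
    (p : ℕ → Seminorm k (StrongDual k V)) (hp : ∀ n, Continuous (p n)) :
    ∃ s : Seminorm k (StrongDual k V), Continuous s ∧ s.IsAdmissible ∧
      ∀ n, ∃ C : ℝ, 0 ≤ C ∧ ∀ φ, p n φ ≤ C * s φ := by
  have := hV.uniformAddGroup
  have := hV.continuousSMul
  obtain ⟨r, hrm, hrc, -, -, hrb⟩ := hV.exists_seminorm_chain (fun _ _ => True)
    (fun _ _ _ _ _ => trivial) (fun q h1 h2 => ⟨q, le_rfl, h1, h2, trivial⟩)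
  obtain ⟨c₀, hc₀⟩ := NormedField.exists_one_lt_norm k
  have hbasis : ∀ n, ∃ (D : Set V) (ε : ℝ), Bornology.IsVonNBounded k D ∧ 0 < ε ∧
      ∀ φ : StrongDual k V, (∀ u ∈ D, ‖φ u‖ < ε) → p n φ < 1 := by
    intro n
    have hX : {φ | p n φ < 1} ∈ 𝓝 (0 : StrongDual k V) :=
      (isOpen_lt (hp n) continuous_const).mem_nhds (by simp)
    obtain ⟨⟨D, ε⟩, ⟨hD, hε⟩, h⟩ := (ContinuousLinearMap.hasBasis_nhds_zero_of_basis
      (Metric.nhds_basis_ball (x := (0 : k)))).mem_iff.1 hX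
    exact ⟨D, ε, hD, hε, fun φ hφ => h fun u hu => by simpa using hφ u hu⟩
  choose D ε hD hε hDp using hbasis
  -- The scaling makes r n ≤ 1 on c n • D n. As r increases, r n ≤ 1 on all later pieces as well, so
  -- only finitely many pieces need separate bounds and the union A is bounded.
  have hc : ∀ n, ∃ c : k, c ≠ 0 ∧ ∀ u ∈ D n, r n (c • u) ≤ 1 := by
    intro n
    obtain ⟨M, hM⟩ := (hD n).exists_seminorm_le (hrc n)
    obtain ⟨c, hc0, hc⟩ := NormedField.exists_norm_lt k (r := (1 + |M|)⁻¹) (by positivity)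
    refine ⟨c, norm_pos_iff.1 hc0, fun u hu => ?_⟩
    rw [map_smul_eq_mul]
    calc ‖c‖ * r n u ≤ (1 + |M|)⁻¹ * (1 + |M|) := by
          gcongr
          exact (hM u hu).trans ((le_abs_self M).trans (by linarith))
      _ = 1 := inv_mul_cancel₀ (by positivity)
  choose c hc0 hc1 using hc
  let A : Set V := ⋃ n, (fun u => c n • u) '' D n
  have hrA : ∀ n, ∃ M, ∀ u ∈ A, r n u ≤ M := by
    intro n
    choose M hM using fun m => (hD m).exists_seminorm_le (hrc n)
    obtain ⟨K, hK⟩ := ((Finset.range n).image fun m => ‖c m‖ * M m).exists_le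
    refine ⟨max K 1, fun u hu => ?_⟩
    obtain ⟨m, u, hum, rfl⟩ := Set.mem_iUnion.1 hu
    rcases lt_or_ge m n with h | h
    · refine le_max_of_le_left (le_trans ?_ (hK _ (Finset.mem_image_of_mem _ (Finset.mem_range.2 h))))
      simp only [map_smul_eq_mul]
      gcongr
      exact hM m u hum
    · exact le_max_of_le_right ((hrm h _).trans (hc1 m u hum))
  have hA : Bornology.IsVonNBounded k A := by
    intro X hX
    obtain ⟨n, hn⟩ := hrb X hX
    obtain ⟨M, hM⟩ := hrA n
    refine (Absorbs.of_norm (E := V) (𝕜 := k) ?_).mono_left hn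
    refine ⟨|M| + 1, fun a ha u hu => ?_⟩
    have ha0 : 0 < ‖a‖ := lt_of_lt_of_le (by positivity) ha
    refine ⟨a⁻¹ • u, ?_, by simp [smul_smul, norm_pos_iff.1 ha0]⟩
    simp only [Set.mem_ofPred_eq, map_smul_eq_mul, norm_inv]
    rw [inv_mul_lt_iff₀ ha0, mul_one]
    have := hM u hu
    have := le_abs_self M
    linarith
  have hbdd : ∀ φ : StrongDual k V, BddAbove (Set.range fun u : A => ‖φ u‖) := by
    intro φ
    obtain ⟨M, hM⟩ := hA.exists_seminorm_le
      (r := (normSeminorm k k).comp (φ : V →ₗ[k] k)) φ.continuous.norm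
    exact ⟨M, by rintro _ ⟨u, rfl⟩; exact hM u u.2⟩
  let s : Seminorm k (StrongDual k V) := Seminorm.ofSMulLE (fun φ => ⨆ u : A, ‖φ u‖) (by simp)
    (fun φ ψ => Real.iSup_le (fun u => (norm_add_le _ _).trans
        (add_le_add (le_ciSup (hbdd φ) u) (le_ciSup (hbdd ψ) u)))
      (add_nonneg (Real.iSup_nonneg fun _ => norm_nonneg _)
        (Real.iSup_nonneg fun _ => norm_nonneg _)))
    (fun a φ => Real.iSup_le (fun u => by
        rw [smul_apply, norm_smul]
        gcongr
        exact le_ciSup (hbdd φ) u)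
      (mul_nonneg (norm_nonneg _) (Real.iSup_nonneg fun _ => norm_nonneg _)))
  have hs : ∀ φ, s φ = ⨆ u : A, ‖φ u‖ := fun φ => rfl
  have hle : ∀ φ u, u ∈ A → ‖φ u‖ ≤ s φ := fun φ u hu => le_ciSup (hbdd φ) ⟨u, hu⟩
  refine ⟨s, ?_, fun hk φ ψ => ?_, fun n => ?_⟩
  · refine Seminorm.continuous' (r := 1) (mem_of_superset
      (ContinuousLinearMap.hasBasis_nhds_zero.mem_of_mem (i := (A, Metric.ball (0 : k) 1))
        ⟨hA, Metric.ball_mem_nhds _ one_pos⟩) fun φ hφ => ?_)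
    rw [Seminorm.mem_closedBall_zero, hs]
    exact Real.iSup_le (fun u => (mem_ball_zero_iff.1 (hφ u u.2)).le) zero_le_one
  · rw [hs (φ + ψ)]
    refine Real.iSup_le (fun u => ?_) (le_max_of_le_left (apply_nonneg _ _))
    exact (IsUltrametricDist.norm_add_le_max (φ u) (ψ u)).trans
      (max_le_max (hle φ u u.2) (hle ψ u u.2))
  -- If s φ < 1, then ‖φ u‖ < ‖c n‖⁻¹ on D n; this choice of t puts t • φ in the neighbourhood on
  -- which p n < 1.
  · obtain ⟨t, ht0, ht⟩ := NormedField.exists_norm_lt k (r := ε n * ‖c n‖)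
      (mul_pos (hε n) (norm_pos_iff.2 (hc0 n)))
    refine ⟨‖c₀‖ * ‖t‖⁻¹, by positivity, (p n).le_mul_of_le_on_ball s hc₀ fun φ hφ => ?_⟩
    have h1 : p n (t • φ) < 1 := by
      refine hDp n _ fun u hu => ?_
      have h2 := (hle φ (c n • u) (Set.mem_iUnion.2 ⟨n, u, hu, rfl⟩)).trans_lt hφ
      rw [map_smul, norm_smul] at h2
      rw [smul_apply, norm_smul]
      have hcpos := norm_pos_iff.2 (hc0 n)
      calc ‖t‖ * ‖φ u‖ ≤ (ε n * ‖c n‖) * ‖φ u‖ := by gcongr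
        _ = ε n * (‖c n‖ * ‖φ u‖) := by ring
        _ < ε n * 1 := mul_lt_mul_of_pos_left h2 (hε n)
        _ = ε n := mul_one _
    rw [map_smul_eq_mul] at h1
    rw [← one_div, le_div_iff₀ ht0, mul_comm]
    exact h1.le

end Frechet

/-! ### Maps from the strong dual of U to V -/

section MapsFromDual

variable {k : Type uk} [NontriviallyNormedField k] {V : Type u} [AddCommGroup V] [Module k V]
  {U : Type w} [AddCommGroup U] [Module k U]

/-- A continuous linear map from the strong dual of a Fréchet space to a Fréchet space
factors through a local Banach space of the dual. -/
theorem exists_factorization_localBanach [UniformSpace V] [UniformSpace U] (hV : IsFrechet k V)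
    (hU : IsFrechet k U) {W : Type v} [AddCommGroup W] [Module k W] [TopologicalSpace W]
    (e : W ≃L[k] StrongDual k U) (g : W →L[k] V) :
    ∃ (s : Seminorm k W) (a : W →L[k] LocalBanach s) (G : LocalBanach s →L[k] V),
      s.IsAdmissible ∧ g = G.comp a := by
  have := hV.uniformAddGroup
  have := hV.continuousSMul
  have := hV.t2
  have := hV.complete
  have := hU.uniformAddGroup
  have := hU.continuousSMul
  have : IsTopologicalAddGroup W := e.toHomeomorph.isInducing.topologicalAddGroup e
  obtain ⟨r, -, hrc, -, -, hrb⟩ := hV.exists_seminorm_chain (fun _ _ => True)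
    (fun _ _ _ _ _ => trivial) (fun q h1 h2 => ⟨q, le_rfl, h1, h2, trivial⟩)
  obtain ⟨s, hsc, hsa, hs⟩ := hU.exists_seminorm_dominating
    (fun n => (r n).comp ((g.comp (e.symm : StrongDual k U →L[k] W) :
      StrongDual k U →L[k] V) : StrongDual k U →ₗ[k] V))
    (fun n => (hrc n).comp (g.continuous.comp e.symm.continuous))
  let s' : Seminorm k W := s.comp ((e : W →L[k] StrongDual k U) : W →ₗ[k] StrongDual k U)
  have hs'c : Continuous s' := hsc.comp e.continuous
  -- Domination of every r n ∘ g by a multiple of s' is precisely the continuity of g for s' alone.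
  let f : SeminormSpace s' →L[k] V :=
    { toLinearMap := (g : W →ₗ[k] V).comp (SeminormSpace.toBase s')
      cont := by
        refine continuous_of_continuousAt_zero
          ((g : W →ₗ[k] V).comp (SeminormSpace.toBase s')) ?_
        rw [ContinuousAt, map_zero]
        intro X hX
        obtain ⟨n, hn⟩ := hrb X hX
        obtain ⟨C, hC0, hC⟩ := hs n
        rw [Filter.mem_map]
        refine mem_of_superset (Metric.ball_mem_nhds (0 : SeminormSpace s')
          (show 0 < (C + 1)⁻¹ by positivity)) fun w hw => hn ?_
        rw [mem_ball_zero_iff, SeminormSpace.norm_eq] at hw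
        have h1 := hC (e (SeminormSpace.toBase s' w))
        have h2 : r n (g (SeminormSpace.toBase s' w)) ≤ C * s' (SeminormSpace.toBase s' w) := by
          simpa [s'] using h1
        refine h2.trans_lt ?_
        have hpos : 0 < C + 1 := by positivity
        calc C * s' (SeminormSpace.toBase s' w)
            ≤ C * (C + 1)⁻¹ := by gcongr
          _ < 1 := by rw [← div_eq_mul_inv, div_lt_one hpos]; linarith }
  obtain ⟨G, hG⟩ := LocalBanach.exists_extension s' hs'c f
  refine ⟨s', LocalBanach.mk s' hs'c, G, fun hk x y => ?_, ?_⟩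
  · simpa [s'] using hsa hk (e x) (e y)
  · ext w
    rw [ContinuousLinearMap.comp_apply, hG]
    rfl

end MapsFromDual

/-! ### Banach spaces continuously included in V -/

section BanachDisc

variable {k : Type uk} [NontriviallyNormedField k] {V : Type u} [AddCommGroup V] [Module k V]

/-- For a sequence `P` of seminorms defining the topology of a complete space, the vectors `v` with
`sup P m v < ∞` form a Banach space. -/
theorem exists_banach_of_seminorms [UniformSpace V] [IsUniformAddGroup V] [T2Space V]
    [CompleteSpace V] (P : ℕ → Seminorm k V) (hPc : ∀ m, Continuous (P m))
    (hPb : ∀ X ∈ 𝓝 (0 : V), ∃ m, ∃ ε > 0, {x | P m x < ε} ⊆ X) :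
    ∃ (F : Type u) (_ : NormedAddCommGroup F) (_ : NormedSpace k F) (ι : F →L[k] V),
      CompleteSpace F ∧ Function.Injective ι ∧
      (∀ v M, (∀ m, P m v ≤ M) → ∃ y, ι y = v) ∧ (∀ y m, P m (ι y) ≤ ‖y‖) ∧
      (∀ y M, 0 ≤ M → (∀ m, P m (ι y) ≤ M) → ‖y‖ ≤ M) ∧
      (IsUltrametricDist k → (∀ m, (P m).IsAdmissible) → IsUltrametricDist F) := by
  let N : Submodule k V :=
    { carrier := {v | BddAbove (Set.range fun m => P m v)}
      zero_mem' := ⟨0, by rintro _ ⟨m, rfl⟩; simp⟩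
      add_mem' := by
        rintro x y ⟨a, ha⟩ ⟨b, hb⟩
        refine ⟨a + b, ?_⟩
        rintro _ ⟨m, rfl⟩
        exact (map_add_le_add (P m) x y).trans (add_le_add (ha ⟨m, rfl⟩) (hb ⟨m, rfl⟩))
      smul_mem' := by
        rintro c x ⟨a, ha⟩
        refine ⟨‖c‖ * a, ?_⟩
        rintro _ ⟨m, rfl⟩
        simp only [map_smul_eq_mul]
        gcongr
        exact ha ⟨m, rfl⟩ }
  have hnn : ∀ x : N, 0 ≤ ⨆ m, P m x := fun x => Real.iSup_nonneg fun m => apply_nonneg _ _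
  have hle : ∀ (x : N) m, P m x ≤ ⨆ m, P m x := fun x m => le_ciSup x.2 m
  let S : Seminorm k N := Seminorm.ofSMulLE (fun x => ⨆ m, P m x) (by simp)
    (fun x y => Real.iSup_le (fun m => (map_add_le_add (P m) (x : V) y).trans
      (add_le_add (hle x m) (hle y m))) (add_nonneg (hnn x) (hnn y)))
    (fun c x => Real.iSup_le (fun m => by
      rw [Submodule.coe_smul, map_smul_eq_mul]
      gcongr
      exact hle x m) (mul_nonneg (norm_nonneg _) (hnn x)))
  let j : SeminormSpace S →ₗ[k] V := N.subtype.comp (SeminormSpace.toBase S)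
  have hjle : ∀ y m, P m (j y) ≤ ‖y‖ := fun y m => hle (SeminormSpace.toBase S y) m
  have hjnorm : ∀ y M, 0 ≤ M → (∀ m, P m (j y) ≤ M) → ‖y‖ ≤ M := fun y M hM h =>
    Real.iSup_le h hM
  have hjsurj : ∀ v M, (∀ m, P m v ≤ M) → ∃ y, j y = v := fun v M h =>
    ⟨SeminormSpace.of S ⟨v, M, by rintro _ ⟨m, rfl⟩; exact h m⟩, rfl⟩
  have hjinj : Function.Injective j := fun x y h => Subtype.ext h
  let inst : NormedSpace k (SeminormSpace S) := inferInstance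
  let _ : NormedAddCommGroup (SeminormSpace S) := NormedAddCommGroup.ofSeparation fun y hy => by
    have h1 : j y = 0 := by
      by_contra hne
      obtain ⟨m, ε, hε, hsub⟩ := hPb {j y}ᶜ (isOpen_compl_singleton.mem_nhds (Ne.symm hne))
      refine hsub (show P m (j y) < ε from ?_) rfl
      exact lt_of_le_of_lt ((hjle y m).trans_eq hy) hε
    exact hjinj (by rw [h1, map_zero])
  let ι : SeminormSpace S →L[k] V :=
    { toLinearMap := j
      cont := by
        refine continuous_of_continuousAt_zero j ?_
        rw [ContinuousAt, map_zero]
        intro X hX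
        obtain ⟨m, ε, hε, hsub⟩ := hPb X hX
        rw [Filter.mem_map]
        refine mem_of_superset (Metric.ball_mem_nhds (0 : SeminormSpace S) hε) fun y hy => ?_
        exact hsub ((hjle y m).trans_lt (mem_ball_zero_iff.1 hy)) }
  refine ⟨SeminormSpace S, _, inst, ι, ?_, hjinj, hjsurj, hjle, hjnorm, ?_⟩
  · refine Metric.complete_of_cauchySeq_tendsto fun x hx => ?_
    obtain ⟨v, hv⟩ := cauchySeq_tendsto_of_complete (ι.uniformContinuous.comp_cauchySeq hx)
    -- The Cauchy estimate is uniform in m and passes to the limit in V for each m by continuity of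
    -- P m. This gives both membership of v in the subspace and convergence in its norm.
    have key : ∀ ε > 0, ∃ n₀, ∀ n ≥ n₀, ∀ m, P m (j (x n) - v) ≤ ε := by
      intro ε hε
      obtain ⟨n₀, hn₀⟩ := Metric.cauchySeq_iff.1 hx ε hε
      refine ⟨n₀, fun n hn m => ?_⟩
      have hlim : Tendsto (fun l => P m (j (x n) - j (x l))) atTop (𝓝 (P m (j (x n) - v))) :=
        ((hPc m).tendsto _).comp (tendsto_const_nhds.sub hv)
      refine le_of_tendsto hlim (eventually_atTop.2 ⟨n₀, fun l hl => ?_⟩)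
      rw [← map_sub]
      refine (hjle _ m).trans ?_
      rw [← dist_eq_norm]
      exact (hn₀ n hn l hl).le
    obtain ⟨n₁, hn₁⟩ := key 1 one_pos
    obtain ⟨y, hy⟩ := hjsurj v (‖x n₁‖ + 1) fun m => by
      have h1 := map_sub_le_add (P m) (j (x n₁)) (j (x n₁) - v)
      rw [sub_sub_cancel] at h1
      exact h1.trans (add_le_add (hjle _ m) (hn₁ n₁ le_rfl m))
    refine ⟨y, Metric.tendsto_atTop.2 fun ε hε => ?_⟩
    obtain ⟨n₀, hn₀⟩ := key (ε / 2) (by positivity)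
    refine ⟨n₀, fun n hn => ?_⟩
    rw [dist_eq_norm]
    refine (hjnorm _ (ε / 2) (by positivity) fun m => ?_).trans_lt (half_lt_self hε)
    rw [map_sub, hy]
    exact hn₀ n hn m
  · intro hk hP
    refine IsUltrametricDist.isUltrametricDist_of_forall_norm_add_le_max_norm fun x y => ?_
    refine hjnorm _ _ (le_max_of_le_left (norm_nonneg _)) fun m => ?_
    rw [map_add]
    exact (hP m hk _ _).trans (max_le_max (hjle x m) (hjle y m))

end BanachDisc

/-! ### Factorization in the ultrametric case -/

section Factorization

variable {k : Type uk} [NontriviallyNormedField k] {V : Type u} [AddCommGroup V] [Module k V]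
  {E : Type v} [NormedAddCommGroup E] [NormedSpace k E]

/-- A continuous linear map with values in a subspace continuously included by `ι` lifts to
this subspace if it is bounded for its norm. -/
theorem ContinuousLinearMap.exists_lift_of_bound [TopologicalSpace V] {F : Type u}
    [NormedAddCommGroup F] [NormedSpace k F] {ι : F →L[k] V} (hι : Function.Injective ι)
    (G : E →L[k] V) (K : ℝ) (h : ∀ x, ∃ y, ι y = G x ∧ ‖y‖ ≤ K * ‖x‖) :
    ∃ T : E →L[k] F, G = ι.comp T := by
  choose τ hτ hτK using h
  let T : E →ₗ[k] F :=
    { toFun := τ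
      map_add' := fun x y => hι (by simp [hτ])
      map_smul' := fun c x => hι (by simp [hτ]) }
  exact ⟨T.mkContinuous K hτK, by ext x; exact (hτ x).symm⟩

/-- The operator norm of the induced map into the completion for p serves as the constant. -/
theorem ContinuousLinearMap.exists_seminorm_apply_le [TopologicalSpace V]
    [IsTopologicalAddGroup V] (G : E →L[k] V) {p : Seminorm k V} (hp : Continuous p) :
    ∃ C : ℝ, 0 ≤ C ∧ ∀ x, p (G x) ≤ C * ‖x‖ :=
  ⟨‖(LocalBanach.mk p hp).comp G‖, norm_nonneg _, fun x => by
    simpa using ((LocalBanach.mk p hp).comp G).le_opNorm x⟩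

/-- Rescaling a defining sequence of seminorms by positive factors gives a defining sequence. -/
theorem exists_rescaled_seminorm_ball_subset [TopologicalSpace V] {r : ℕ → Seminorm k V}
    (hrb : ∀ X ∈ 𝓝 (0 : V), ∃ n, {x | r n x < 1} ⊆ X) {c : ℕ → NNReal} (hc : ∀ n, 0 < c n) :
    ∀ X ∈ 𝓝 (0 : V), ∃ m, ∃ ε > 0, {x | (c m • r m) x < ε} ⊆ X := by
  intro X hX
  obtain ⟨n, hn⟩ := hrb X hX
  refine ⟨n, c n, NNReal.coe_pos.2 (hc n), fun x hx => hn ?_⟩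
  have h1 : (c n : ℝ) * r n x < c n := hx
  have h2 : (0 : ℝ) < c n := NNReal.coe_pos.2 (hc n)
  exact (mul_lt_iff_lt_one_right h2).1 h1

/-- Over a locally compact ultrametric field, a continuous linear map from a Banach space to an
(FN)-space factors through a nuclear operator of Banach spaces. -/
theorem IsFN.exists_nuclear_factorization_of_ultrametric [IsUltrametricDist k] [ProperSpace k]
    [IsUltrametricDist E] [UniformSpace V] (hV : IsFN k V) (G : E →L[k] V) :
    ∃ (F : Type u) (_ : NormedAddCommGroup F) (_ : NormedSpace k F) (T : E →L[k] F)
      (b : F →L[k] V), CompleteSpace F ∧ IsUltrametricDist F ∧ IsNuclearOperator T ∧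
      G = b.comp T := by
  have := hV.frechet.uniformAddGroup
  have := hV.frechet.continuousSMul
  have := hV.frechet.t2
  have := hV.frechet.complete
  obtain ⟨r, hrm, hrc, hra, -, hrb⟩ := hV.frechet.exists_seminorm_chain (fun _ _ => True)
    (fun _ _ _ _ _ => trivial) (fun q h1 h2 => ⟨q, le_rfl, h1, h2, trivial⟩)
  choose C hC0 hC using fun n => G.exists_seminorm_apply_le (hrc n)
  -- The division by 1 + C n bounds the n-th weighted seminorm of G x by 2⁻ⁿ ‖x‖.
  let c : ℕ → NNReal := fun n => ⟨(1 / 2) ^ n / (1 + C n), by have := hC0 n; positivity⟩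
  have hcv : ∀ n, (c n : ℝ) = (1 / 2) ^ n / (1 + C n) := fun n => rfl
  have hc : ∀ n, 0 < c n := fun n => NNReal.coe_pos.1 (by
    rw [hcv]; have := hC0 n; positivity)
  have hc1 : ∀ n, (c n : ℝ) ≤ 1 := fun n => by
    rw [hcv]
    have := hC0 n
    exact div_le_one_of_le₀ ((pow_le_one₀ (by norm_num) (by norm_num)).trans (by linarith))
      (by positivity)
  have hP : ∀ n x, (c n • r n) x = c n * r n x := fun n x => rfl
  have hPG : ∀ n x, (c n • r n) (G x) ≤ (1 / 2) ^ n * ‖x‖ := fun n x => by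
    have hn := hC0 n
    rw [hP, hcv, div_mul_eq_mul_div, div_le_iff₀ (by positivity), mul_assoc]
    gcongr
    refine (hC n x).trans ?_
    nlinarith [norm_nonneg x]
  obtain ⟨F, _, _, ι, hFc, hinj, hsurj, hle, hnorm, hult⟩ := exists_banach_of_seminorms
    (fun n => c n • r n) (fun n => continuous_const.mul (hrc n))
    (exists_rescaled_seminorm_ball_subset hrb hc)
  have hFu : IsUltrametricDist F := hult ‹_› fun m hk x y => by
    rw [hP, hP, hP, ← mul_max_of_nonneg _ _ (NNReal.coe_nonneg _)]
    gcongr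
    exact hra m hk x y
  obtain ⟨T, hT⟩ := ContinuousLinearMap.exists_lift_of_bound hinj G 1 fun x => by
    have hb : ∀ m, (c m • r m) (G x) ≤ 1 * ‖x‖ := fun m => (hPG m x).trans (by
      gcongr
      exact pow_le_one₀ (by norm_num) (by norm_num))
    obtain ⟨y, hy⟩ := hsurj (G x) _ hb
    exact ⟨y, hy, hnorm y _ (by positivity) fun m => by rw [hy]; exact hb m⟩
  have hTG : ∀ x, ι (T x) = G x := fun x => by rw [hT]; rfl
  refine ⟨F, _, _, T, ι, hFc, hFu, IsCompactOperator.isNuclearOperator ?_, hT⟩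
  -- Two points of the unit ball differ by at most 2, so weighted seminorms of index at least M
  -- contribute less than ε/2. Those of index at most M are bounded by r M, for which the compact
  -- link provides a finite net.
  have htb : TotallyBounded (T '' Metric.closedBall 0 1) := by
    refine Metric.totallyBounded_iff.2 fun ε hε => ?_
    obtain ⟨M, hM⟩ := exists_pow_lt_of_lt_one (show 0 < ε / 4 by positivity)
      (show (1 / 2 : ℝ) < 1 by norm_num)
    obtain ⟨q, hpq, hqc, -, hlink, -⟩ := hV.nuclear (r M) (hrc M) (hra M)
    have hcomp := (hlink ‹_›).comp_clm ((LocalBanach.mk q hqc).comp G)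
    obtain ⟨K, hK, hKsub⟩ := IsCompactOperator.image_closedBall_subset_compact (𝕜₁ := k)
      (f := (((LocalBanach.link hpq).comp ((LocalBanach.mk q hqc).comp G) :
        E →L[k] LocalBanach (r M)) : E →ₗ[k] LocalBanach (r M))) hcomp 1
    obtain ⟨t, hts, htf, hcov⟩ :=
      Metric.finite_approx_of_totallyBounded (hK.totallyBounded.subset hKsub) (ε / 2)
        (by positivity)
    obtain ⟨t', htsub, htfin, rfl⟩ := Set.exists_subset_image_finite_and.1 ⟨t, hts, htf, rfl⟩
    refine ⟨T '' t', htfin.image T, ?_⟩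
    rintro _ ⟨x, hx, rfl⟩
    have hxc := hcov (Set.mem_image_of_mem _ hx)
    simp only [Set.mem_iUnion, Set.mem_image, exists_prop, exists_exists_and_eq_and] at hxc ⊢
    obtain ⟨z, hz, hxz⟩ := hxc
    refine ⟨z, hz, ?_⟩
    have hd : r M (G x - G z) < ε / 2 := by
      rw [Metric.mem_ball, dist_eq_norm, ← map_sub] at hxz
      have he : (LocalBanach.link hpq) (LocalBanach.mk q hqc (G (x - z))) =
          LocalBanach.mk (r M) (hrc M) (G (x - z)) := LocalBanach.link_mk _ _ _ _
      have : ‖(LocalBanach.link hpq) (LocalBanach.mk q hqc (G (x - z)))‖ < ε / 2 := hxz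
      rwa [he, LocalBanach.norm_mk, map_sub] at this
    rw [Metric.mem_ball, dist_eq_norm, ← map_sub]
    refine (hnorm _ (ε / 2) (by positivity) fun m => ?_).trans_lt (half_lt_self hε)
    rw [hTG]
    rcases le_total m M with h | h
    · rw [hP, map_sub]
      calc (c m : ℝ) * r m (G x - G z) ≤ 1 * r M (G x - G z) := by
            gcongr
            · exact hc1 m
            · exact hrm h _
        _ ≤ ε / 2 := by linarith
    · have hxz2 : ‖x - z‖ ≤ 2 := by
        have h1 : ‖x‖ ≤ 1 := by simpa using hx
        have h2 : ‖z‖ ≤ 1 := by simpa using htsub hz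
        exact (norm_sub_le x z).trans (by linarith)
      calc (c m • r m) (G (x - z)) ≤ (1 / 2) ^ m * ‖x - z‖ := hPG m _
        _ ≤ (1 / 2) ^ M * 2 := by
            gcongr ?_ * ?_
            exact pow_le_pow_of_le_one (by norm_num) (by norm_num) h
        _ ≤ ε / 2 := by linarith
  rw [isCompactOperator_iff_exists_mem_nhds_image_subset_compact]
  exact ⟨Metric.closedBall 0 1, Metric.closedBall_mem_nhds _ one_pos, _,
    htb.closure.isCompact_of_isClosed isClosed_closure, subset_closure⟩

end Factorization

/-! ### Finite rank approximation from nuclear links -/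

section Approximation

variable {k : Type uk} [NontriviallyNormedField k] {V : Type u} [AddCommGroup V] [Module k V]

/-- The identity from `(V, q)` to `(V, p)` is approximated by finite rank operators
whose nuclear norms stay bounded. -/
def Seminorm.NuclearlyDominated [TopologicalSpace V] (p q : Seminorm k V) : Prop :=
  ∃ N : ℝ, 0 ≤ N ∧ ∀ ε > 0, ∃ (J : ℕ) (ψ : ℕ → V →L[k] k) (a : ℕ → ℝ) (y : ℕ → V),
    (∀ j, 0 ≤ a j) ∧ (∀ j x, ‖ψ j x‖ ≤ a j * q x) ∧
    ∑ j ∈ Finset.range J, a j * p (y j) ≤ N ∧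
    ∀ x, p (x - ∑ j ∈ Finset.range J, ψ j x • y j) ≤ ε * q x

theorem Seminorm.NuclearlyDominated.mono [TopologicalSpace V] {p q q' : Seminorm k V}
    (h : p.NuclearlyDominated q) (hq : q ≤ q') : p.NuclearlyDominated q' := by
  obtain ⟨N, hN, h⟩ := h
  refine ⟨N, hN, fun ε hε => ?_⟩
  obtain ⟨J, ψ, a, y, h1, h2, h3, h4⟩ := h ε hε
  refine ⟨J, ψ, a, y, h1, fun j x => (h2 j x).trans ?_, h3, fun x => (h4 x).trans ?_⟩
  · have := h1 j
    gcongr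
    exact hq x
  · gcongr
    exact hq x

/-- The vectors of a nuclear expansion lie in the completion rather than in V. Truncation leaves a
small tail, and density moves the finitely many remaining vectors into V at an additional cost of at
most 1. -/
theorem IsNuclearOperator.nuclearlyDominated [TopologicalSpace V] [IsTopologicalAddGroup V]
    (hk : ¬ IsUltrametricDist k) {p q : Seminorm k V} {h : p ≤ q} (hp : Continuous p)
    (hq : Continuous q) (hT : IsNuclearOperator (LocalBanach.link h)) :
    p.NuclearlyDominated q := by
  obtain ⟨φ, z, -, hsum, hT⟩ := hT
  have hs := hsum hk
  refine ⟨∑' n, ‖φ n‖ * ‖z n‖ + 1, by positivity, fun ε' hε' => ?_⟩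
  set ε := min ε' 1 with hε
  have hε0 : 0 < ε := lt_min hε' one_pos
  obtain ⟨J, hJ⟩ : ∃ J, ∑' n, ‖φ (n + J)‖ * ‖z (n + J)‖ < ε / 2 :=
    ((tendsto_sum_nat_add fun n => ‖φ n‖ * ‖z n‖).eventually
      (gt_mem_nhds (show 0 < ε / 2 by positivity))).exists
  -- With this tolerance the J replacement errors, weighted by ‖φ j‖, add up to at most ε/2; the two
  -- added ones avoid division by zero.
  have happ : ∀ j, ∃ y, ‖z j - LocalBanach.mk p hp y‖ < ε / (2 * (J + 1) * (‖φ j‖ + 1)) := by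
    intro j
    obtain ⟨y, hy⟩ := (LocalBanach.denseRange_mk p hp).exists_dist_lt (z j)
      (ε := ε / (2 * (J + 1) * (‖φ j‖ + 1))) (by positivity)
    exact ⟨y, by rwa [← dist_eq_norm]⟩
  choose y hy using happ
  have hφy : ∀ j, ‖φ j‖ * ‖z j - LocalBanach.mk p hp (y j)‖ ≤ ε / (2 * (J + 1)) := by
    intro j
    calc ‖φ j‖ * ‖z j - LocalBanach.mk p hp (y j)‖
        ≤ (‖φ j‖ + 1) * (ε / (2 * (J + 1) * (‖φ j‖ + 1))) := by
          gcongr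
          · linarith
          · exact (hy j).le
      _ = ε / (2 * (J + 1)) := by field_simp
  have hsumφy : ∑ j ∈ Finset.range J, ‖φ j‖ * ‖z j - LocalBanach.mk p hp (y j)‖ ≤ ε / 2 := by
    refine (Finset.sum_le_card_nsmul _ _ _ fun j _ => hφy j).trans ?_
    rw [Finset.card_range, nsmul_eq_mul, mul_div_assoc', div_le_div_iff₀ (by positivity)
      (by positivity)]
    nlinarith
  refine ⟨J, fun j => (φ j).comp (LocalBanach.mk q hq), fun j => ‖φ j‖, y,
    fun j => norm_nonneg _, fun j x => ?_, ?_, fun x => ?_⟩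
  · simpa using (φ j).le_opNorm (LocalBanach.mk q hq x)
  · have h1 : ∀ j, ‖φ j‖ * p (y j) ≤
        ‖φ j‖ * ‖z j‖ + ‖φ j‖ * ‖z j - LocalBanach.mk p hp (y j)‖ := fun j => by
      rw [← mul_add, ← LocalBanach.norm_mk p hp]
      gcongr
      have := norm_sub_le (z j) (z j - LocalBanach.mk p hp (y j))
      rwa [sub_sub_cancel] at this
    refine (Finset.sum_le_sum fun j _ => h1 j).trans ?_
    rw [Finset.sum_add_distrib]
    refine add_le_add (hs.sum_le_tsum _ fun _ _ => by positivity) (hsumφy.trans ?_)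
    have : ε ≤ 1 := min_le_right _ _
    linarith
  · set X := LocalBanach.mk q hq x with hX
    have hXn : ‖X‖ = q x := LocalBanach.norm_mk q hq x
    have h1 : LocalBanach.mk p hp (x - ∑ j ∈ Finset.range J, φ j X • y j) =
        (LocalBanach.link h X - ∑ j ∈ Finset.range J, φ j X • z j) +
          ∑ j ∈ Finset.range J, φ j X • (z j - LocalBanach.mk p hp (y j)) := by
      rw [hX, LocalBanach.link_mk h hp hq, map_sub, map_sum]
      simp only [map_smul, smul_sub, Finset.sum_sub_distrib]
      abel
    have h2 : ‖LocalBanach.link h X - ∑ j ∈ Finset.range J, φ j X • z j‖ ≤ ε / 2 * q x := by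
      have h3 : HasSum (fun n => φ (n + J) X • z (n + J))
          (LocalBanach.link h X - ∑ j ∈ Finset.range J, φ j X • z j) :=
        (hasSum_nat_add_iff' J).2 (hT X)
      have h4 : HasSum (fun n => ‖φ (n + J)‖ * ‖z (n + J)‖ * q x)
          ((∑' n, ‖φ (n + J)‖ * ‖z (n + J)‖) * q x) :=
        ((summable_nat_add_iff J).2 hs).hasSum.mul_right _
      refine (h3.norm_le_of_bounded h4 fun n => ?_).trans (by gcongr)
      rw [norm_smul, mul_right_comm, ← hXn]
      gcongr
      exact (φ (n + J)).le_opNorm X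
    have h5 : ‖∑ j ∈ Finset.range J, φ j X • (z j - LocalBanach.mk p hp (y j))‖ ≤
        ε / 2 * q x := by
      refine (norm_sum_le _ _).trans ((Finset.sum_le_sum fun j _ => ?_).trans
        ((Finset.sum_mul _ _ _).symm.trans_le (mul_le_mul_of_nonneg_right hsumφy
          (apply_nonneg q x))))
      rw [norm_smul, mul_right_comm, ← hXn]
      gcongr
      exact (φ j).le_opNorm X
    calc p (x - ∑ j ∈ Finset.range J, φ j X • y j)
        = ‖LocalBanach.mk p hp (x - ∑ j ∈ Finset.range J, φ j X • y j)‖ :=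
          (LocalBanach.norm_mk p hp _).symm
      _ ≤ ε / 2 * q x + ε / 2 * q x := by
          rw [h1]
          exact (norm_add_le _ _).trans (add_le_add h2 h5)
      _ = ε * q x := by ring
      _ ≤ ε' * q x := by
          gcongr
          exact min_le_left _ _

end Approximation

/-! ### Nuclear series and factorization in the archimedean case -/

section Assembly

variable {k : Type uk} [NontriviallyNormedField k] {V : Type u} [AddCommGroup V] [Module k V]
  {E : Type v} [NormedAddCommGroup E] [NormedSpace k E]

/-- An absolutely convergent expansion indexed by a countable type defines a nuclear operator. -/
theorem isNuclearOperator_of_countable (hk : ¬ IsUltrametricDist k) {F : Type w}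
    [NormedAddCommGroup F] [NormedSpace k F] {T : E →L[k] F} {I : Type} [Countable I]
    (φ : I → StrongDual k E) (y : I → F) (hs : Summable fun i => ‖φ i‖ * ‖y i‖)
    (hT : ∀ x, HasSum (fun i => φ i x • y i) (T x)) : IsNuclearOperator T := by
  obtain ⟨e, he⟩ := exists_injective_nat I
  have hφ : ∀ n ∉ Set.range e, Function.extend e φ 0 n = 0 := fun n hn =>
    Function.extend_apply' _ _ _ hn
  refine ⟨Function.extend e φ 0, Function.extend e y 0, fun h => (hk h).elim, fun _ => ?_,
    fun x => ?_⟩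
  · refine (he.summable_iff fun n hn => by rw [hφ n hn]; simp).1 ?_
    convert hs using 2 with i
    simp [he.extend_apply]
  · refine (he.hasSum_iff fun n hn => by rw [hφ n hn]; simp).1 ?_
    convert hT x using 2 with i
    simp [he.extend_apply]

/-- Countably many summable families admit positive weights making the total family summable. -/
theorem exists_weights_summable {I : Type} (a : ℕ → I → ℝ) (ha : ∀ m i, 0 ≤ a m i)
    (hs : ∀ m, Summable (a m)) :
    ∃ (c : ℕ → NNReal) (b : I → ℝ), (∀ m, 0 < c m) ∧ Summable b ∧ ∀ m i, c m * a m i ≤ b i := by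
  have hA : ∀ m, 0 ≤ ∑' i, a m i := fun m => tsum_nonneg (ha m)
  let c : ℕ → NNReal := fun m => ⟨(1 / 2) ^ m / (1 + ∑' i, a m i), by have := hA m; positivity⟩
  have hcv : ∀ m, (c m : ℝ) = (1 / 2) ^ m / (1 + ∑' i, a m i) := fun m => rfl
  have hprod : Summable fun x : ℕ × I => (c x.1 : ℝ) * a x.1 x.2 := by
    have hnn : 0 ≤ fun x : ℕ × I => (c x.1 : ℝ) * a x.1 x.2 := fun x =>
      mul_nonneg (NNReal.coe_nonneg _) (ha _ _)
    refine (summable_prod_of_nonneg hnn).2 ⟨fun m => (hs m).mul_left (c m : ℝ), ?_⟩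
    refine Summable.of_nonneg_of_le (fun m => tsum_nonneg fun i =>
      mul_nonneg (NNReal.coe_nonneg _) (ha _ _)) (fun m => ?_) summable_geometric_two
    have := hA m
    change ∑' i, (c m : ℝ) * a m i ≤ (1 / 2) ^ m
    rw [tsum_mul_left, hcv, div_mul_eq_mul_div, div_le_iff₀ (by positivity)]
    gcongr
    linarith
  have hsymm := hprod.prod_symm
  refine ⟨c, fun i => ∑' m, c m * a m i, fun m => NNReal.coe_pos.1 ?_, hsymm.prod, fun m i => ?_⟩
  · have := hA m
    rw [hcv]
    positivity
  · exact (hsymm.prod_factor i).le_tsum m fun _ _ => mul_nonneg (NNReal.coe_nonneg _) (ha _ _)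

/-- A continuous linear map from a Banach space to a Fréchet space which is the sum of a series of
finite rank operators, absolutely convergent for each seminorm, factors through a nuclear
operator of Banach spaces. -/
theorem exists_nuclear_factorization_of_series (hk : ¬ IsUltrametricDist k) [UniformSpace V]
    (hV : IsFrechet k V) {r : ℕ → Seminorm k V} (hrc : ∀ n, Continuous (r n))
    (hrb : ∀ X ∈ 𝓝 (0 : V), ∃ n, {x | r n x < 1} ⊆ X) (G : E →L[k] V)
    (ι : ℕ → Type) [∀ n, Fintype (ι n)] (φ : ∀ n, ι n → StrongDual k E) (v : ∀ n, ι n → V)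
    (hs : ∀ m, Summable fun n => ∑ i, ‖φ n i‖ * r m (v n i))
    (hlim : ∀ x, Tendsto (fun N => ∑ n ∈ Finset.range N, ∑ i, φ n i x • v n i) atTop
      (𝓝 (G x))) :
    ∃ (F : Type u) (_ : NormedAddCommGroup F) (_ : NormedSpace k F) (T : E →L[k] F)
      (b : F →L[k] V), CompleteSpace F ∧ IsNuclearOperator T ∧ G = b.comp T := by
  have := hV.uniformAddGroup
  have := hV.continuousSMul
  have := hV.t2
  have := hV.complete
  have ha : ∀ m (i : Σ n, ι n), 0 ≤ ‖φ i.1 i.2‖ * r m (v i.1 i.2) := fun m i => by positivity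
  obtain ⟨c, b, hc, hb, hcb⟩ := exists_weights_summable
    (fun m (i : Σ n, ι n) => ‖φ i.1 i.2‖ * r m (v i.1 i.2)) ha fun m =>
      (summable_sigma_of_nonneg (ha m)).2 ⟨fun n => (hasSum_fintype _).summable, by
        simpa only [tsum_fintype] using hs m⟩
  have hP : ∀ n x, (c n • r n) x = c n * r n x := fun n x => rfl
  obtain ⟨F, _, _, j, hFc, hinj, hsurj, hle, hnorm, -⟩ := exists_banach_of_seminorms
    (fun n => c n • r n) (fun n => continuous_const.mul (hrc n))
    (exists_rescaled_seminorm_ball_subset hrb hc)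
  have hb0 : ∀ i, 0 ≤ b i := fun i =>
    (mul_nonneg (NNReal.coe_nonneg _) (ha 0 i)).trans (hcb 0 i)
  have hy : ∀ i : Σ n, ι n, ∃ y : F, (∀ x, j (φ i.1 i.2 x • y) = φ i.1 i.2 x • v i.1 i.2) ∧
      ‖φ i.1 i.2‖ * ‖y‖ ≤ b i := by
    intro i
    -- When the functional vanishes, the summability bound says nothing about v, which may lie
    -- outside F; its term is replaced by 0.
    rcases eq_or_ne (φ i.1 i.2) 0 with h0 | h0
    · exact ⟨0, by simp [h0], by simpa using hb0 i⟩
    · have hpos : 0 < ‖φ i.1 i.2‖ := norm_pos_iff.2 h0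
      have hbd : ∀ m, (c m • r m) (v i.1 i.2) ≤ b i / ‖φ i.1 i.2‖ := fun m => by
        rw [hP, le_div_iff₀ hpos]
        have := hcb m i
        linarith
      obtain ⟨y, hy⟩ := hsurj _ _ hbd
      refine ⟨y, fun x => by rw [map_smul, hy], ?_⟩
      rw [mul_comm, ← le_div_iff₀ hpos]
      exact hnorm y _ (div_nonneg (hb0 i) hpos.le) fun m => by rw [hy]; exact hbd m
  choose y hjy hyb using hy
  have hterm : ∀ x i, ‖φ i.1 i.2 x • y i‖ ≤ b i * ‖x‖ := fun x i => by
    rw [norm_smul]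
    calc ‖φ i.1 i.2 x‖ * ‖y i‖ ≤ ‖φ i.1 i.2‖ * ‖x‖ * ‖y i‖ := by
          gcongr
          exact (φ i.1 i.2).le_opNorm x
      _ = ‖φ i.1 i.2‖ * ‖y i‖ * ‖x‖ := by ring
      _ ≤ b i * ‖x‖ := by
          gcongr
          exact hyb i
  have hsum : ∀ x, Summable fun i : Σ n, ι n => φ i.1 i.2 x • y i := fun x =>
    Summable.of_norm_bounded (hb.mul_right ‖x‖) (hterm x)
  have hjsum : ∀ x, j (∑' i : Σ n, ι n, φ i.1 i.2 x • y i) = G x := by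
    intro x
    have h1 := (hsum x).hasSum.mapL j
    simp only [hjy] at h1
    have h2 := h1.sigma fun n => hasSum_fintype _
    exact tendsto_nhds_unique h2.tendsto_sum_nat (hlim x)
  obtain ⟨T, hT⟩ := ContinuousLinearMap.exists_lift_of_bound hinj G (∑' i, b i) fun x =>
    ⟨_, hjsum x, tsum_of_norm_bounded (hb.hasSum.mul_right ‖x‖) (hterm x)⟩
  refine ⟨F, _, _, T, j, hFc, isNuclearOperator_of_countable hk (fun i : Σ n, ι n => φ i.1 i.2)
    y (Summable.of_nonneg_of_le (fun i => by positivity) hyb hb) fun x => ?_, hT⟩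
  have hTx : T x = ∑' i : Σ n, ι n, φ i.1 i.2 x • y i := hinj (by rw [hjsum, hT]; rfl)
  rw [hTx]
  exact (hsum x).hasSum

/-- Over an archimedean field, a continuous linear map from a Banach space to an (FN)-space
factors through a nuclear operator of Banach spaces. -/
theorem IsFN.exists_nuclear_factorization_of_not_ultrametric (hk : ¬ IsUltrametricDist k)
    [UniformSpace V] (hV : IsFN k V) (G : E →L[k] V) :
    ∃ (F : Type u) (_ : NormedAddCommGroup F) (_ : NormedSpace k F) (T : E →L[k] F)
      (b : F →L[k] V), CompleteSpace F ∧ IsNuclearOperator T ∧ G = b.comp T := by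
  have := hV.frechet.uniformAddGroup
  have := hV.frechet.continuousSMul
  obtain ⟨r, hrm, hrc, -, hR, hrb⟩ := hV.frechet.exists_seminorm_chain
    Seminorm.NuclearlyDominated (fun _ _ _ h h' => h.mono h') (fun p hp hpa => by
      obtain ⟨q, hpq, hqc, hqa, -, hnuc⟩ := hV.nuclear p hp hpa
      exact ⟨q, hpq, hqc, hqa, (hnuc hk).nuclearlyDominated hk hp hqc⟩)
  choose C hC0 hC using fun n => G.exists_seminorm_apply_le (hrc n)
  choose N hN0 hN using hR
  -- The summands are the factors that δ n must absorb: from (1 - P_n) P_{n+1}, from P_{n-1} (1 -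
  -- P_n), and from the convergence P_n G x → G x.
  let K : ℕ → ℝ := fun n => N (n + 1) * C (n + 2) + N (n - 1) * C (n + 1) + C (n + 1)
  have hK1 : ∀ n, 0 ≤ N (n + 1) * C (n + 2) := fun n => mul_nonneg (hN0 _) (hC0 _)
  have hK2 : ∀ n, 0 ≤ N (n - 1) * C (n + 1) := fun n => mul_nonneg (hN0 _) (hC0 _)
  have hK0 : ∀ n, 0 ≤ K n := fun n => add_nonneg (add_nonneg (hK1 n) (hK2 n)) (hC0 _)
  let δ : ℕ → ℝ := fun n => (1 / 2) ^ n / (1 + K n)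
  have hδ0 : ∀ n, 0 < δ n := fun n => by have := hK0 n; positivity
  have hδ : ∀ n t, t ≤ K n → δ n * t ≤ (1 / 2) ^ n := fun n t ht => by
    have := hK0 n
    rw [div_mul_eq_mul_div, div_le_iff₀ (by positivity)]
    gcongr
    linarith
  choose J ψ a y ha hψ hcost happ using fun n => hN n (δ n) (hδ0 n)
  let P : ℕ → V →L[k] V := fun n => ∑ j ∈ Finset.range (J n), (ψ n j).smulRight (y n j)
  have hPx : ∀ n x, P n x = ∑ j ∈ Finset.range (J n), ψ n j x • y n j := fun n x => by
    simp [P]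
  have hPapp : ∀ n x, r n (x - P n x) ≤ δ n * r (n + 1) x := fun n x => by
    rw [hPx]
    exact happ n x
  -- The two summands of the index type carry (1 - P_n) P_{n+1} G, with 1 - P_n applied to the
  -- vectors, and -P_n (1 - P_{n+1}) G, with 1 - P_{n+1} absorbed into the functionals. Each costs
  -- at most 2⁻ⁿ for r n.
  have hblock : ∀ n, ∃ (ι : Type) (_ : Fintype ι) (φ : ι → StrongDual k E) (v : ι → V),
      (∀ x, ∑ i, φ i x • v i = P (n + 1) (G x) - P n (G x)) ∧
      ∑ i, ‖φ i‖ * r n (v i) ≤ 2 * (1 / 2) ^ n := by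
    intro n
    refine ⟨Fin (J (n + 1)) ⊕ Fin (J n), inferInstance,
      Sum.elim (fun j => (ψ (n + 1) j).comp G)
        (fun j => -(ψ n j).comp (G - (P (n + 1)).comp G)),
      Sum.elim (fun j => y (n + 1) j - P n (y (n + 1) j)) (fun j => y n j), fun x => ?_, ?_⟩
    · simp only [Fintype.sum_sum_type, Sum.elim_inl, Sum.elim_inr, smul_sub,
        Finset.sum_sub_distrib]
      have e1 : ∑ j : Fin (J (n + 1)), ((ψ (n + 1) j).comp G) x • y (n + 1) j =
          P (n + 1) (G x) := by
        rw [hPx, Finset.sum_range]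
        rfl
      have e2 : ∑ j : Fin (J (n + 1)), ((ψ (n + 1) j).comp G) x • P n (y (n + 1) j) =
          P n (P (n + 1) (G x)) := by
        rw [← e1, map_sum]
        simp only [map_smul]
      have e3 : ∑ j : Fin (J n), (-(ψ n j).comp (G - (P (n + 1)).comp G)) x • y n j =
          -P n (G x - P (n + 1) (G x)) := by
        rw [hPx n (G x - _), Finset.sum_range, ← Finset.sum_neg_distrib]
        exact Finset.sum_congr rfl fun j _ => by rw [← neg_smul]; rfl
      rw [e1, e2, e3, map_sub]
      abel
    · simp only [Fintype.sum_sum_type, Sum.elim_inl, Sum.elim_inr]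
      have e1 : ∑ j : Fin (J (n + 1)), ‖(ψ (n + 1) j).comp G‖ *
          r n (y (n + 1) j - P n (y (n + 1) j)) ≤ (1 / 2) ^ n := by
        calc _ ≤ ∑ j : Fin (J (n + 1)), (C (n + 2) * δ n) *
              (a (n + 1) j * r (n + 1) (y (n + 1) j)) := by
              refine Finset.sum_le_sum fun j _ => ?_
              have h1 : ‖(ψ (n + 1) j).comp G‖ ≤ a (n + 1) j * C (n + 2) := by
                refine ContinuousLinearMap.opNorm_le_bound _ (mul_nonneg (ha _ _) (hC0 _))
                  fun x => (hψ (n + 1) j (G x)).trans ?_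
                rw [mul_assoc]
                exact mul_le_mul_of_nonneg_left (hC (n + 2) x) (ha _ _)
              calc _ ≤ (a (n + 1) j * C (n + 2)) * (δ n * r (n + 1) (y (n + 1) j)) :=
                    mul_le_mul h1 (hPapp n _) (apply_nonneg _ _)
                      (mul_nonneg (ha _ _) (hC0 _))
                _ = _ := by ring
          _ ≤ (C (n + 2) * δ n) * N (n + 1) := by
              rw [← Finset.mul_sum, Fin.sum_univ_eq_sum_range
                (fun j => a (n + 1) j * r (n + 1) (y (n + 1) j))]
              exact mul_le_mul_of_nonneg_left (hcost (n + 1))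
                (mul_nonneg (hC0 _) (hδ0 n).le)
          _ = δ n * (N (n + 1) * C (n + 2)) := by ring
          _ ≤ (1 / 2) ^ n := hδ n _ (by
              have := hK2 n
              have := hC0 (n + 1)
              simp only [K]
              linarith)
      have e2 : ∑ j : Fin (J n), ‖-(ψ n j).comp (G - (P (n + 1)).comp G)‖ * r n (y n j) ≤
          (1 / 2) ^ n := by
        calc _ ≤ ∑ j : Fin (J n), (δ (n + 1) * C (n + 2)) * (a n j * r n (y n j)) := by
              refine Finset.sum_le_sum fun j _ => ?_
              have h1 : ‖-(ψ n j).comp (G - (P (n + 1)).comp G)‖ ≤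
                  (δ (n + 1) * C (n + 2)) * a n j := by
                rw [norm_neg]
                refine ContinuousLinearMap.opNorm_le_bound _ (mul_nonneg (mul_nonneg
                  (hδ0 _).le (hC0 _)) (ha _ _)) fun x => (hψ n j _).trans ?_
                calc a n j * r (n + 1) (G x - P (n + 1) (G x))
                    ≤ a n j * (δ (n + 1) * (C (n + 2) * ‖x‖)) := by
                      refine mul_le_mul_of_nonneg_left ((hPapp (n + 1) _).trans ?_) (ha _ _)
                      exact mul_le_mul_of_nonneg_left (hC (n + 2) x) (hδ0 _).le
                  _ = _ := by ring
              calc _ ≤ (δ (n + 1) * C (n + 2)) * a n j * r n (y n j) := by gcongr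
                _ = _ := by ring
          _ ≤ (δ (n + 1) * C (n + 2)) * N n := by
              rw [← Finset.mul_sum, Fin.sum_univ_eq_sum_range (fun j => a n j * r n (y n j))]
              exact mul_le_mul_of_nonneg_left (hcost n) (mul_nonneg (hδ0 _).le (hC0 _))
          _ = δ (n + 1) * (N n * C (n + 2)) := by ring
          _ ≤ (1 / 2) ^ (n + 1) := hδ (n + 1) _ (by
              have := hK1 (n + 1)
              have := hC0 (n + 1 + 1)
              simp only [K, Nat.add_sub_cancel]
              linarith)
          _ ≤ (1 / 2) ^ n := pow_le_pow_of_le_one (by norm_num) (by norm_num) n.le_succ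
      linarith
  -- Block 0 is P_0 G and block n + 1 is the n-th difference. Block 0 needs no estimate, since
  -- summability for r m only concerns the blocks with n ≥ m + 1.
  have hblock' : ∀ n, ∃ (ι : Type) (_ : Fintype ι) (φ : ι → StrongDual k E) (v : ι → V),
      (∀ x, ∑ i, φ i x • v i = P n (G x) - (if n = 0 then 0 else P (n - 1) (G x))) ∧
      (n ≠ 0 → ∑ i, ‖φ i‖ * r (n - 1) (v i) ≤ 2 * (1 / 2) ^ (n - 1)) := by
    rintro (_ | n)
    · refine ⟨Fin (J 0), inferInstance, fun j => (ψ 0 j).comp G, fun j => y 0 j, fun x => ?_,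
        fun h => (h rfl).elim⟩
      rw [if_pos rfl, sub_zero, hPx, Finset.sum_range]
      rfl
    · obtain ⟨ι, hι, φ, v, h1, h2⟩ := hblock n
      exact ⟨ι, hι, φ, v, fun x => by simpa using h1 x, fun _ => h2⟩
  choose ι hι φ v hφ hφcost using hblock'
  refine exists_nuclear_factorization_of_series hk hV.frechet hrc hrb G ι φ v (fun m => ?_)
    fun x => ?_
  · have hg : Summable fun n => 2 * 2 * (1 / 2 : ℝ) ^ n := summable_geometric_two.mul_left _
    refine Summable.of_norm_bounded_eventually_nat hg (eventually_atTop.2 ⟨m + 1, fun n hn => ?_⟩)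
    have hn1 : n - 1 + 1 = n := by omega
    rw [Real.norm_of_nonneg (Finset.sum_nonneg fun i _ => by positivity)]
    calc ∑ i, ‖φ n i‖ * r m (v n i) ≤ ∑ i, ‖φ n i‖ * r (n - 1) (v n i) := by
          gcongr with i
          exact hrm (show m ≤ n - 1 by omega) _
      _ ≤ 2 * (1 / 2) ^ (n - 1) := hφcost n (by omega)
      _ = 2 * 2 * (1 / 2) ^ n := by
          rw [← hn1, Nat.add_sub_cancel, pow_succ]
          ring
  · have hpart : ∀ M, ∑ n ∈ Finset.range (M + 1), ∑ i, φ n i x • v n i = P M (G x) := by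
      intro M
      induction M with
      | zero => simp [hφ]
      | succ M ih => rw [Finset.sum_range_succ, ih, hφ]; simp
    rw [← tendsto_add_atTop_iff_nat 1]
    simp only [hpart]
    rw [← tendsto_sub_nhds_zero_iff]
    intro X hX
    obtain ⟨m, hm⟩ := hrb X hX
    obtain ⟨M, hM⟩ := exists_pow_lt_of_lt_one (show 0 < (1 + ‖x‖)⁻¹ by positivity)
      (show (1 / 2 : ℝ) < 1 by norm_num)
    rw [Filter.mem_map]
    filter_upwards [eventually_ge_atTop (max m M)] with n hn
    refine hm ?_
    have h1 : r n (P n (G x) - G x) ≤ (1 / 2) ^ n * ‖x‖ := by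
      rw [map_sub_rev]
      calc r n (G x - P n (G x)) ≤ δ n * (C (n + 1) * ‖x‖) :=
            (hPapp n _).trans (mul_le_mul_of_nonneg_left (hC (n + 1) x) (hδ0 n).le)
        _ = δ n * C (n + 1) * ‖x‖ := by ring
        _ ≤ (1 / 2) ^ n * ‖x‖ := by
            gcongr
            refine hδ n _ ?_
            have := hK1 n
            have := hK2 n
            simp only [K]
            linarith
    calc r m (P n (G x) - G x) ≤ r n (P n (G x) - G x) := hrm ((le_max_left _ _).trans hn) _
      _ ≤ (1 / 2) ^ n * ‖x‖ := h1
      _ ≤ (1 / 2) ^ M * ‖x‖ := by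
          gcongr ?_ * _
          exact pow_le_pow_of_le_one (by norm_num) (by norm_num) ((le_max_right _ _).trans hn)
      _ ≤ (1 + ‖x‖)⁻¹ * ‖x‖ := by gcongr
      _ < 1 := by
          rw [inv_mul_lt_iff₀ (by positivity)]
          linarith

end Assembly

/-! ### The main theorem -/

theorem mainTheorem4 (k : Type uk) [NontriviallyNormedField k] (hk : IsLocalFieldCharZero k)
    (V : Type u) [AddCommGroup V] [Module k V] [UniformSpace V] (hV : IsFN k V)
    (W : Type v) [AddCommGroup W] [Module k W] [TopologicalSpace W]
    (hW : IsDFN.{uk, v, w} k W) :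
    (∀ f : V →L[k] W, IsNuclearMap f) ∧ (∀ g : W →L[k] V, IsNuclearMap g) := by
  have := hk.locallyCompact
  have : ProperSpace k := ProperSpace.of_locallyCompactSpace k
  obtain ⟨U, _, _, _, hU, ⟨e⟩⟩ := hW
  refine ⟨fun f => ?_, fun g => ?_⟩
  · refine isNuclearMap_of_nuclear_links hV.frechet hU.frechet (fun p hp hpa => ?_) e f
    obtain ⟨q, hpq, hqc, hqa, hcomp, hnuc⟩ := hV.nuclear p hp hpa
    refine ⟨q, hpq, hqc, hqa, ?_⟩
    by_cases hu : IsUltrametricDist k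
    · have := LocalBanach.isUltrametricDist hpa
      have := LocalBanach.isUltrametricDist hqa
      exact (hcomp hu).isNuclearOperator
    · exact hnuc hu
  · obtain ⟨s, a, G, hs, rfl⟩ := exists_factorization_localBanach hV.frechet hU.frechet e g
    by_cases hu : IsUltrametricDist k
    · have := LocalBanach.isUltrametricDist hs
      obtain ⟨F, _, _, T, b, hF, hFu, hT, rfl⟩ :=
        hV.exists_nuclear_factorization_of_ultrametric G
      exact ⟨LocalBanach s, inferInstance, inferInstance, F, _, _, a, T, b, inferInstance, hF,
        fun _ => ⟨this, hFu⟩, hT, rfl⟩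
    · obtain ⟨F, _, _, T, b, hF, hT, rfl⟩ :=
        hV.exists_nuclear_factorization_of_not_ultrametric hu G
      exact ⟨LocalBanach s, inferInstance, inferInstance, F, _, _, a, T, b, inferInstance, hF,
        fun h => (hu h).elim, hT, rfl⟩
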